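/- **Model.** There are $n$ parties, connected pairwise by authenticated channels; time is counted in ticks $0,1,2,\dots$. There are a known delay bound $\Delta\ge 1$ and an unknown Global Stabilization Time (GST) such that a word sent by an uncorrupted party at time $s$ is received after time $s$ and by time $\max\{s,\mathrm{GST}\}+\Delta$; within these limits the adversary schedules deliveries. An adaptive adversary, which sees all words sent, may corrupt parties at any time and then controls them completely. *Honest* parties are those never corrupted; $f$ is the number of parties corrupted during the execution. *Signatures.* There are a PKI and a constant number of threshold signature schemes, each with a set of members and a threshold $k$, in which partial signatures of $k$ distinct members on the same statement combine into one threshold signature. Signatures are ideal (unforgeable). A signed statement consists of a constant number of bits and a view number. A *word* consists of a constant number of bits and a constant number of signatures, and is stamped with the view in which it is sent; a party itself only signs statements about views it has been in. *Views.* Each party is in a numbered view at each time. The numbers never decrease, and every honest party passes through infinitely many views. Before GST, different parties may be in arbitrarily different views. From GST on, each party moves through the views one by one, uncorrupted parties are at most one view apart, and an uncorrupted party leaves a view that it entered after GST only after all uncorrupted parties have been in that view simultaneously for $L\cdot\Delta$ ticks, where $L$ is a constant of the protocol. (With perfectly synchronized clocks, views given by consecutive time periods of length $L\Delta$ have these properties.)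 A deterministic protocol fixes, for each party, its possible decision and the words it sends as functions of its input and of all it has observed; a party acts only when it starts, when its view changes, or when it receives words. **Theorem.** There are absolute constants $L$ and $C$ (and constant bounds on the number of threshold schemes and on the size of a word) such that for all $n,t\ge 0$ with $t<n/3$ and all $\Delta\ge1$ there is a deterministic protocol for $n$ parties that solves strong binary Byzantine Agreement in partial synchrony against up to $t$ faults. That is, in every execution as above with $f\le t$, for every choice of inputs in $\{0,1\}$ and every GST: 1. (Termination) every honest party eventually decides a value; 2. (Agreement) no two honest parties decide different values, and no honest party decides two different values; 3. (Strong Unanimity) if all honest parties have the same input $v$, then every honest party decides $v$; 4. (Communication) from time GST on, at most $C\,(n+t\cdot f)$ words in total are sent by parties that are uncorrupted when sending. -/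

import Mathlib

/-!
Deterministic protocols for `n` parties in a partially synchronous message-passing network with
a PKI and threshold signatures, against an adaptive Byzantine adversary.  Time is counted in
ticks `0, 1, 2, …`.  Signatures are symbolic terms: `Sig.single p m` is the only signature of
`m` that verifies under the key of `p`, and terms can only be obtained through `Derivable`.
-/
namespace PartialSynchrony

/-- A signable statement: one of `c` constant-size contents, together with a view number. -/
structure Stmt (c : ℕ) where
  view : ℕ
  body : Fin c

/-- The parameters of a threshold signature scheme: who takes part, and how many partial
signatures are needed. -/
structure Scheme (n : ℕ) where
  members : Finset (Fin n)
  threshold : ℕ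

/-- Signatures: ordinary signatures `sign_p(m)`, partial signatures `tsign_p(m)` of the `i`-th
threshold scheme, and combined threshold signatures of the `i`-th scheme. -/
inductive Sig (n r c : ℕ) where
  | single (p : Fin n) (m : Stmt c)
  | share (i : Fin r) (p : Fin n) (m : Stmt c)
  | full (i : Fin r) (m : Stmt c)

/-- A word: a constant amount of data and a constant number of signatures. -/
structure Word (n r c : ℕ) where
  body : Fin c
  sigs : List (Sig n r c)
  size : sigs.length ≤ c

/-- What travels over a channel: a word stamped with a view number (for honest senders, always
the view in which the word was sent). -/
structure Packet (n r c : ℕ) where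
  view : ℕ
  word : Word n r c

/-- What a party observes when it is activated: the view it is in, and the packets that are
delivered to it, each with its (authenticated) sender. -/
structure Batch (n r c : ℕ) where
  view : ℕ
  inbox : List (Fin n × Packet n r c)

/-- The signatures that can be produced from a set `known` of signatures by somebody who can
use the key of `p` on the statement `m` exactly when `canSign p m`. -/
inductive Derivable {n r c : ℕ} (S : Fin r → Scheme n) (canSign : Fin n → Stmt c → Prop)
    (known : Set (Sig n r c)) : Sig n r c → Prop
  | known {σ : Sig n r c} (h : σ ∈ known) : Derivable S canSign known σ
  | sign {p : Fin n} {m : Stmt c} (h : canSign p m) : Derivable S canSign known (Sig.single p m)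
  | tsign {i : Fin r} {p : Fin n} {m : Stmt c} (h : canSign p m) (hp : p ∈ (S i).members) :
      Derivable S canSign known (Sig.share i p m)
  | tcombine {i : Fin r} {m : Stmt c} (A : Finset (Fin n)) (hA : A ⊆ (S i).members)
      (hcard : A.card = (S i).threshold)
      (h : ∀ p ∈ A, Derivable S canSign known (Sig.share i p m)) :
      Derivable S canSign known (Sig.full i m)

/-- The signatures contained in the packets of a local history. -/
def receivedSigs {n r c : ℕ} (h : List (Batch n r c)) : Set (Sig n r c) :=
  {σ | ∃ B ∈ h, ∃ x ∈ B.inbox, σ ∈ x.2.word.sigs}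

/-- A deterministic protocol.  A local history lists everything that the party has observed,
newest observation first.  `send p b h` are the words, with their recipients, that party `p` with
input `b` sends when it is activated and its history has become `h`; `decide p b h` is the value
decided by then, if any.  Party `p` signs with its own key only, and only statements about views
that it has been in; every other signature it sends it has received or combined. -/
structure Protocol (n r c : ℕ) where
  schemes : Fin r → Scheme n
  send : Fin n → Bool → List (Batch n r c) → List (Fin n × Word n r c)
  decide : Fin n → Bool → List (Batch n r c) → Option Bool
  send_derivable : ∀ p b h, ∀ x ∈ send p b h, ∀ σ ∈ x.2.sigs,
    Derivable schemes (fun q m => q = p ∧ ∃ B ∈ h, B.view = m.view) (receivedSigs h) σ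

/-- The data of a run.  `corruptAt p` is the tick from which on the adversary controls `p`
(`⊤` if this never happens), `view p τ` is the view that `p` is in at tick `τ`, and `inbox p τ`
are the packets delivered to `p` at tick `τ`. -/
structure Run (n r c : ℕ) where
  input : Fin n → Bool
  corruptAt : Fin n → ℕ∞
  view : Fin n → ℕ → ℕ
  inbox : Fin n → ℕ → List (Fin n × Packet n r c)

namespace Run

variable {n r c : ℕ}

/-- A party is activated when it starts, when its view changes and when it receives packets.
It has no other access to time. -/
def Active (R : Run n r c) (p : Fin n) : ℕ → Prop
  | 0 => True
  | τ + 1 => R.view p (τ + 1) ≠ R.view p τ ∨ R.inbox p (τ + 1) ≠ []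

open Classical in
/-- The local history of `p` up to and including tick `τ`. -/
noncomputable def hist (R : Run n r c) (p : Fin n) : ℕ → List (Batch n r c)
  | 0 => [⟨R.view p 0, R.inbox p 0⟩]
  | τ + 1 =>
    if R.Active p (τ + 1) then ⟨R.view p (τ + 1), R.inbox p (τ + 1)⟩ :: R.hist p τ
    else R.hist p τ

open Classical in
/-- The words, with their recipients, that the protocol makes `p` send at tick `τ`. -/
noncomputable def sent (R : Run n r c) (P : Protocol n r c) (p : Fin n) (τ : ℕ) :
    List (Fin n × Word n r c) :=
  if R.Active p τ then P.send p (R.input p) (R.hist p τ) else []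

/-- `p` is not (yet) corrupted at tick `τ`. -/
def Uncorrupted (R : Run n r c) (p : Fin n) (τ : ℕ) : Prop := (τ : ℕ∞) < R.corruptAt p

/-- `p` is honest: it is never corrupted. -/
def Honest (R : Run n r c) (p : Fin n) : Prop := R.corruptAt p = ⊤

open Classical in
/-- The actual number of faults `f`. -/
noncomputable def numFaulty (R : Run n r c) : ℕ :=
  (Finset.univ.filter fun p => ¬ R.Honest p).card

/-- The signatures that the adversary has seen before tick `τ`: all that were sent by parties
that were not corrupted when sending. -/
def seenSigs (R : Run n r c) (P : Protocol n r c) (τ : ℕ) : Set (Sig n r c) :=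
  {σ | ∃ p s, s < τ ∧ R.Uncorrupted p s ∧ ∃ x ∈ R.sent P p s, σ ∈ x.2.sigs}

/-- The run is an execution of `P` over authenticated channels: a packet delivered as coming
from `p` was sent by `p` to this recipient following the protocol before `p` was corrupted, or
`p` is corrupted and the adversary made up the packet from the keys of the corrupted parties and
the signatures it has seen.  (Beyond what a network does, packets may be delivered repeatedly.) -/
def IsExecution (R : Run n r c) (P : Protocol n r c) : Prop :=
  ∀ (q : Fin n) (τ : ℕ) (p : Fin n) (k : Packet n r c), (p, k) ∈ R.inbox q τ →
    (∃ s w, s < τ ∧ R.Uncorrupted p s ∧ (q, w) ∈ R.sent P p s ∧ k = ⟨R.view p s, w⟩) ∨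
    (¬ R.Uncorrupted p τ ∧ ∀ σ ∈ k.word.sigs,
      Derivable P.schemes (fun x _ => ¬ R.Uncorrupted x τ) (R.seenSigs P τ) σ)

/-- A word that an uncorrupted party sends at tick `s` is received by tick
`max s GST + Δ`. -/
def PartiallySynchronous (R : Run n r c) (P : Protocol n r c) (Δ GST : ℕ) : Prop :=
  ∀ (p q : Fin n) (s : ℕ) (w : Word n r c), R.Uncorrupted p s → (q, w) ∈ R.sent P p s →
    ∃ τ, s < τ ∧ τ ≤ max s GST + Δ ∧ (p, ⟨R.view p s, w⟩) ∈ R.inbox q τ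

/-- The view abstraction.  Views never decrease and honest parties pass through infinitely many.
From `GST` on, parties move through the views one by one, uncorrupted parties are at most one
view apart, and a party leaves a view that it entered after `GST` only after all uncorrupted
parties have been in it together for `D` ticks.  Before `GST` nothing else is assumed. -/
structure ViewsSynchronized (R : Run n r c) (D GST : ℕ) : Prop where
  mono : ∀ p, Monotone (R.view p)
  unbounded : ∀ p, R.Honest p → ∀ k, ∃ τ, k ≤ R.view p τ
  step : ∀ p τ, GST ≤ τ → R.view p (τ + 1) ≤ R.view p τ + 1
  close : ∀ p q τ, GST ≤ τ → R.Uncorrupted p τ → R.Uncorrupted q τ →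
    R.view q τ ≤ R.view p τ + 1
  overlap : ∀ p τ, R.Uncorrupted p (τ + 1) → R.view p GST < R.view p τ →
    R.view p τ < R.view p (τ + 1) →
    ∃ a, GST ≤ a ∧ a + D ≤ τ + 1 ∧
      ∀ q s, a ≤ s → s < a + D → R.Uncorrupted q s → R.view q s = R.view p τ

/-- At tick `τ`, party `p` has decided `v`. -/
def Decided (R : Run n r c) (P : Protocol n r c) (p : Fin n) (τ : ℕ) (v : Bool) : Prop :=
  P.decide p (R.input p) (R.hist p τ) = some v

/-- Every honest party eventually decides. -/
def Termination (R : Run n r c) (P : Protocol n r c) : Prop :=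
  ∀ p, R.Honest p → ∃ τ v, R.Decided P p τ v

/-- No two honest parties, and no honest party at two times, decide different values. -/
def Agreement (R : Run n r c) (P : Protocol n r c) : Prop :=
  ∀ p q τ τ' v v', R.Honest p → R.Honest q → R.Decided P p τ v → R.Decided P q τ' v' → v = v'

/-- If all honest parties have the same input `v`, then they all decide `v`. -/
def StrongUnanimity (R : Run n r c) (P : Protocol n r c) : Prop :=
  ∀ v, (∀ p, R.Honest p → R.input p = v) → ∀ p, R.Honest p → ∃ τ, R.Decided P p τ v

open Classical in
/-- The number of words sent by parties that are uncorrupted when sending, during the ticks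
`a ≤ τ < b`. -/
noncomputable def wordsSent (R : Run n r c) (P : Protocol n r c) (a b : ℕ) : ℕ :=
  ∑ τ ∈ Finset.Ico a b, ∑ p : Fin n, if R.Uncorrupted p τ then (R.sent P p τ).length else 0

end Run

end PartialSynchrony

/-! After GST, views shared for two delay bounds act as lock-step rounds (`delivered`): a word sent
on entering a view has arrived when its recipient leaves that view. On these rounds a committee of
3t+1 parties runs leader-based consensus with locks. A vote certificate takes 2t+1 votes, and a
commit certificate takes 2t+1 members holding a vote certificate. Two quorums share an honest
member, which is locked once it has helped to commit and afterwards rejects proposals of lower rank;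
this gives `vote_after_commit`, hence agreement. Every chain of justifications ends in t+1 signed
inputs, one of them honest, which gives unanimity (`input_of_vote`).

For liveness, if no honest member has the decision, an honest leader hears the locks of all of them
and proposes a value that they all accept (`exists_votable`). Otherwise a member that has the
decision hands it over (`committee_knows`). Among f+3 consecutive superviews after GST one has an
honest leader, so this takes O(f) superviews, most of them costing O(t) words and at most six
costing O(n).

Spreading the decision must cost O(n+tf) although views go on forever. Therefore only parties
without the decision ask for it, and a party answers a given asker once. Answers to honest parties
are paid by the need of the asker (`sum_supply`); answers to faulty parties number O(tf)
(`sum_wasted_le`). Outside the committee, each group of 3t+1 parties has a rotating representative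
that asks the committee, and then the others ask the representative. An honest representative
settles the matter for its group, so after a good superview at most n/(3t+1) honest and f faulty
parties ask the committee, at 3t+1 words each (`sum_asksCommittee_le`). A party asks in vain only
faulty members of its own group, each at most once (`sum_asksGroup_le`). -/

namespace PartialSynchrony

open scoped Classical

/-! ### Local histories, and views as lock-step rounds. -/

namespace Run

variable {n r c : ℕ} {R : Run n r c}

/-- `p` enters the view that it is in at tick `τ` at this tick. -/
def Enters (R : Run n r c) (p : Fin n) (τ : ℕ) : Prop := ∀ s < τ, R.view p s < R.view p τ

theorem Enters.active {p : Fin n} {τ : ℕ} (h : R.Enters p τ) : R.Active p τ := by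
  cases τ with
  | zero => trivial
  | succ τ => exact Or.inl (h τ (Nat.lt_succ_self τ)).ne'

theorem active_of_mem_inbox {p : Fin n} {τ : ℕ} {x : Fin n × Packet n r c}
    (h : x ∈ R.inbox p τ) : R.Active p τ := by
  cases τ with
  | zero => trivial
  | succ τ => exact Or.inr (List.ne_nil_of_mem h)

theorem mem_hist_iff {p : Fin n} {τ : ℕ} {B : Batch n r c} :
    B ∈ R.hist p τ ↔ ∃ s ≤ τ, R.Active p s ∧ B = ⟨R.view p s, R.inbox p s⟩ := by
  induction τ with
  | zero =>
    simp only [hist, List.mem_singleton, Nat.le_zero, exists_eq_left]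
    simp [Active]
  | succ τ ih =>
    rw [hist]
    split_ifs with h
    · rw [List.mem_cons, ih]
      constructor
      · rintro (rfl | ⟨s, hs, hB⟩)
        · exact ⟨_, le_rfl, h, rfl⟩
        · exact ⟨s, by omega, hB⟩
      · rintro ⟨s, hs, ha, hB⟩
        rcases Nat.lt_or_eq_of_le hs with hs | rfl
        · exact Or.inr ⟨s, by omega, ha, hB⟩
        · exact Or.inl hB
    · rw [ih]
      constructor
      · rintro ⟨s, hs, hB⟩
        exact ⟨s, by omega, hB⟩
      · rintro ⟨s, hs, ha, hB⟩
        rcases Nat.lt_or_eq_of_le hs with hs | rfl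
        · exact ⟨s, by omega, ha, hB⟩
        · exact absurd ha h

theorem hist_eq_cons {p : Fin n} {τ : ℕ} (h : R.Active p τ) :
    ∃ tl, R.hist p τ = ⟨R.view p τ, R.inbox p τ⟩ :: tl ∧
      ∀ B, B ∈ tl ↔ ∃ s < τ, R.Active p s ∧ B = ⟨R.view p s, R.inbox p s⟩ := by
  cases τ with
  | zero => exact ⟨[], rfl, by simp⟩
  | succ τ =>
    refine ⟨R.hist p τ, by rw [hist, if_pos h], fun B => ?_⟩
    rw [mem_hist_iff]
    simp only [Nat.lt_succ_iff]

theorem hist_suffix {p : Fin n} {s τ : ℕ} (h : s ≤ τ) : R.hist p s <:+ R.hist p τ := by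
  induction τ, h using Nat.le_induction with
  | base => exact List.suffix_rfl
  | succ τ _ ih =>
    rw [hist]
    split_ifs
    · exact ih.trans (List.suffix_cons _ _)
    · exact ih

theorem hist_ne_of_lt {p : Fin n} {s τ : ℕ} (h : s < τ) (ha : R.Active p τ) :
    R.hist p s ≠ R.hist p τ := by
  obtain ⟨τ, rfl⟩ : ∃ k, τ = k + 1 := ⟨τ - 1, by omega⟩
  intro he
  have h1 := (hist_suffix (R := R) (p := p) (Nat.lt_succ_iff.1 h)).length_le
  have h2 : (R.hist p (τ + 1)).length = (R.hist p τ).length + 1 := by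
    rw [hist, if_pos ha, List.length_cons]
  rw [he] at h1
  omega

theorem eq_hist_of_suffix {p : Fin n} {τ : ℕ} {l : List (Batch n r c)} (h : l <:+ R.hist p τ) :
    l = [] ∨ ∃ s ≤ τ, R.Active p s ∧ l = R.hist p s := by
  induction τ with
  | zero =>
    rw [hist, List.suffix_cons_iff] at h
    rcases h with h | h
    · exact Or.inr ⟨0, le_rfl, trivial, h⟩
    · exact Or.inl (List.suffix_nil.1 h)
  | succ τ ih =>
    by_cases ha : R.Active p (τ + 1)
    · rw [hist, if_pos ha, List.suffix_cons_iff] at h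
      rcases h with h | h
      · exact Or.inr ⟨τ + 1, le_rfl, ha, by rw [hist, if_pos ha, h]⟩
      · rcases ih h with h | ⟨s, hs, h⟩
        · exact Or.inl h
        · exact Or.inr ⟨s, by omega, h⟩
    · rw [hist, if_neg ha] at h
      rcases ih h with h | ⟨s, hs, h⟩
      · exact Or.inl h
      · exact Or.inr ⟨s, by omega, h⟩

theorem mem_receivedSigs_hist {p : Fin n} {τ : ℕ} {σ : Sig n r c} :
    σ ∈ receivedSigs (R.hist p τ) ↔ ∃ s ≤ τ, ∃ x ∈ R.inbox p s, σ ∈ x.2.word.sigs := by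
  constructor
  · rintro ⟨B, hB, x, hx, hσ⟩
    obtain ⟨s, hs, -, rfl⟩ := mem_hist_iff.1 hB
    exact ⟨s, hs, x, hx, hσ⟩
  · rintro ⟨s, hs, x, hx, hσ⟩
    exact ⟨_, mem_hist_iff.2 ⟨s, hs, active_of_mem_inbox hx, rfl⟩, x, hx, hσ⟩

theorem Uncorrupted.mono {p : Fin n} {s τ : ℕ} (h : R.Uncorrupted p τ) (hs : s ≤ τ) :
    R.Uncorrupted p s :=
  lt_of_le_of_lt (by exact_mod_cast hs) h

theorem Honest.uncorrupted {p : Fin n} (h : R.Honest p) (τ : ℕ) : R.Uncorrupted p τ := by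
  rw [Uncorrupted, h]
  exact ENat.natCast_lt_top τ

theorem Enters.eq_of_view_eq {p : Fin n} {s τ : ℕ} (hs : R.Enters p s) (hτ : R.Enters p τ)
    (h : R.view p s = R.view p τ) : s = τ := by
  rcases lt_trichotomy s τ with h' | h' | h'
  · exact absurd h (hτ s h').ne
  · exact h'
  · exact absurd h (hs τ h').ne'

namespace ViewsSynchronized

variable {D GST : ℕ}

/-- Views advance by at most one per tick after `GST`, so the first tick that reaches `v` hits it
exactly. -/
theorem exists_enters (hV : R.ViewsSynchronized D GST) {p : Fin n} {τ v : ℕ}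
    (h0 : R.view p GST < v) (h : v ≤ R.view p τ) :
    ∃ s ≤ τ, GST < s ∧ R.Enters p s ∧ R.view p s = v := by
  have hex : ∃ s, v ≤ R.view p s := ⟨τ, h⟩
  obtain ⟨hs, hmin⟩ := And.intro (Nat.find_spec hex) (fun {m} => Nat.find_min hex (m := m))
  have hle := Nat.find_min' hex h
  generalize Nat.find hex = s at *
  have hG : GST < s := by
    by_contra hc
    exact absurd (hV.mono p (not_lt.1 hc)) (by omega)
  have hlt := hmin (m := s - 1) (by omega)
  have hst := hV.step p (s - 1) (by omega)
  rw [Nat.sub_add_cancel (by omega)] at hst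
  have hv : R.view p s = v := by omega
  exact ⟨s, hle, hG, fun a ha => by have := hmin ha; omega, hv⟩

theorem exists_leaves (hV : R.ViewsSynchronized D GST) {q : Fin n} {τ v : ℕ}
    (h0 : R.view q GST < v) (h : v < R.view q τ)
    (hq : R.Uncorrupted q τ) :
    ∃ a, GST ≤ a ∧ a + D ≤ τ ∧
      ∀ p s, a ≤ s → s < a + D → R.Uncorrupted p s → R.view p s = v := by
  obtain ⟨s, hs, hG, hent, hv⟩ := hV.exists_enters (v := v + 1) (by omega) h
  obtain ⟨s, rfl⟩ : ∃ k, s = k + 1 := ⟨s - 1, by omega⟩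
  have h1 := hV.step q s (by omega)
  have h2 := hent s (by omega)
  have h3 : R.view q s = v := by omega
  obtain ⟨a, ha, hD, hall⟩ := hV.overlap q s (hq.mono hs) (by omega) (by omega)
  exact ⟨a, ha, by omega, fun p s h1 h2 h3' => by rw [hall p s h1 h2 h3', h3]⟩

/-- After `GST`, the views are lock-step rounds: a word sent in a view `≤ v` has arrived by the
time that a party leaves `v`. -/
theorem delivered {P : Protocol n r c} {Δ : ℕ} (hV : R.ViewsSynchronized (2 * Δ) GST)
    (hS : R.PartiallySynchronous P Δ GST) (hΔ : 0 < Δ) {p q : Fin n} {s τ v : ℕ}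
    {w : Word n r c} (hp : R.Uncorrupted p s) (hw : (q, w) ∈ R.sent P p s)
    (hent : R.Enters p s) (hsv : R.view p s ≤ v) (h0 : R.view q GST < v) (h : v < R.view q τ)
    (hq : R.Uncorrupted q τ) :
    ∃ s' ≤ τ, R.view q s' ≤ v ∧ (p, ⟨R.view p s, w⟩) ∈ R.inbox q s' := by
  obtain ⟨a, ha, hD, hall⟩ := hV.exists_leaves h0 h hq
  -- A sender that enters its view after `a` is in `v` at `a`, so it would be sending in a view
  -- above `v`.
  have hsa : s ≤ a := by
    by_contra hc
    have hpa : R.view p a = v := hall p a le_rfl (by omega) (hp.mono (by omega))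
    exact absurd (hent a (by omega)) (by omega)
  obtain ⟨s', h1, h2, h3⟩ := hS p q s w hp hw
  have hmax : max s GST ≤ a := max_le hsa ha
  refine ⟨s', by omega, ?_, h3⟩
  -- The word is due by `a + Δ`, and `0 < Δ` puts this tick inside the common stay of length `2 * Δ`
  -- in `v`.
  have := hall q (a + Δ) (by omega) (by omega) (hq.mono (by omega))
  rw [← this]
  exact hV.mono q (by omega)

end ViewsSynchronized

end Run

/-! ### Choosing at most one element. -/

/-- The elements, at most one, chosen among those that satisfy `P`. -/
noncomputable def pick {α : Type*} (P : α → Prop) : List α :=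
  if h : ∃ a, P a then [h.choose] else []

theorem of_mem_pick {α : Type*} {P : α → Prop} {a : α} (h : a ∈ pick P) : P a := by
  unfold pick at h
  split_ifs at h with h'
  · rw [List.mem_singleton.1 h]
    exact h'.choose_spec
  · simp at h

theorem exists_mem_pick {α : Type*} {P : α → Prop} (h : ∃ a, P a) : ∃ a, a ∈ pick P :=
  ⟨h.choose, by simp [pick, h]⟩

theorem eq_of_mem_pick {α : Type*} {P : α → Prop} {a b : α} (ha : a ∈ pick P)
    (hb : b ∈ pick P) : a = b := by
  unfold pick at ha hb
  split_ifs at ha hb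
  · rw [List.mem_singleton.1 ha, List.mem_singleton.1 hb]
  · simp at ha

theorem length_pick_le {α : Type*} (P : α → Prop) : (pick P).length ≤ 1 := by
  unfold pick
  split_ifs <;> simp

/-!
The protocol.  The parties `p < 3t+1` form a committee, and the parties are divided into groups
`{p | p / (3t+1) = j}`.  A party sends words only when it enters a view.  Seven consecutive views
`7k, …, 7k+6` form the superview `k`, and `3t+3` superviews form an epoch.  In the first `3t+1`
superviews of an epoch the committee members take turns in leading an attempt to reach a decision.
In the next one, a member of each group asks the committee for the decision, and in the last one
the others ask this member.
-/
namespace CommitteeBA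

variable {n : ℕ}

/-- In superview `k`, party `p` asks party `q` for the decision, unless `p` has it already. -/
def Target (t : ℕ) (p q : Fin n) (k : ℕ) : Prop :=
  (p.val < 3 * t + 1 ∧ q.val < 3 * t + 1 ∧ k % (3 * t + 3) < 3 * t + 1 ∧
    (p.val = k % (3 * t + 3) ∨ q.val = k % (3 * t + 3))) ∨
  (3 * t + 1 ≤ p.val ∧ q.val < 3 * t + 1 ∧ k % (3 * t + 3) = 3 * t + 1 ∧
    p.val % (3 * t + 1) = k / (3 * t + 3) % (3 * t + 1)) ∨
  (3 * t + 1 ≤ p.val ∧ k % (3 * t + 3) = 3 * t + 2 ∧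
    q.val = p.val / (3 * t + 1) * (3 * t + 1) + k / (3 * t + 3) % (3 * t + 1))

/-- Committee member `p` leads superview `k`. -/
def Leads (t : ℕ) (p : Fin n) (k : ℕ) : Prop :=
  p.val < 3 * t + 1 ∧ p.val = k % (3 * t + 3)

/-- The committee. -/
def committee (t n : ℕ) : Finset (Fin n) := Finset.univ.filter fun p => p.val < 3 * t + 1

/-- Scheme `0` certifies inputs, scheme `1` certifies votes. -/
def schemes (t n : ℕ) (i : Fin 2) : Scheme n :=
  ⟨committee t n, if i = 0 then t + 1 else 2 * t + 1⟩

/-- Commit certificates are those on a statement about the view `7j+5` of a superview `j`. -/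
def IsCommit (σ : Sig n 2 2) : Prop := ∃ j b, σ = Sig.full 1 ⟨7 * j + 5, b⟩

/-- The part of a history that precedes superview `k`. -/
def early (k : ℕ) (h : List (Batch n 2 2)) : List (Batch n 2 2) :=
  h.filter fun B => B.view < 7 * k

/-- The decision was known when superview `k` started. -/
def HasDecision (k : ℕ) (h : List (Batch n 2 2)) : Prop :=
  ∃ σ ∈ receivedSigs (early k h), IsCommit σ

/-- A vote certificate of a superview before `k` was received. -/
def Lock (k : ℕ) (h : List (Batch n 2 2)) (ρ : ℕ) (b : Fin 2) : Prop :=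
  Sig.full 1 ⟨ρ, b⟩ ∈ receivedSigs h ∧ ρ % 7 = 3 ∧ ρ < 7 * k

/-- A vote certificate of the highest view among those of superviews before `k`. -/
def TopLock (k : ℕ) (h : List (Batch n 2 2)) (σ : Sig n 2 2) : Prop :=
  ∃ ρ b, σ = Sig.full 1 ⟨ρ, b⟩ ∧ Lock k h ρ b ∧ ∀ ρ' b', Lock k h ρ' b' → ρ' ≤ ρ

/-- The certificate of scheme `i` on `m` can be combined from received shares. -/
def Combinable (t : ℕ) (h : List (Batch n 2 2)) (i : Fin 2) (m : Stmt 2) : Prop :=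
  ∃ A ⊆ (schemes t n i).members, A.card = (schemes t n i).threshold ∧
    ∀ p ∈ A, Sig.share i p m ∈ receivedSigs h

/-- A packet that `q` stamped with view `v` was received. -/
def Heard (h : List (Batch n 2 2)) (q : Fin n) (v : ℕ) : Prop :=
  ∃ B ∈ h, ∃ x ∈ B.inbox, x.1 = q ∧ x.2.view = v

/-- The last observation of `h` is the entry into view `v`. -/
def Fresh (h : List (Batch n 2 2)) (v : ℕ) : Prop :=
  ∃ B tl, h = B :: tl ∧ B.view = v ∧ ∀ B' ∈ tl, B'.view < v

/-- Party `p` enters the second view of a superview in which `q` has asked it for the decision. -/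
def Asked (t : ℕ) (p q : Fin n) (h : List (Batch n 2 2)) : Prop :=
  ∃ k, Fresh h (7 * k + 1) ∧ HasDecision k h ∧ Target t q p k ∧ Heard h q (7 * k)

/-- Party `p` gives the decision to `q`, which it does only once. -/
def Answers (t : ℕ) (p q : Fin n) (h : List (Batch n 2 2)) : Prop :=
  Asked t p q h ∧ ∀ h', h' <:+ h → h' ≠ h → ¬ Asked t p q h'

/-- `σ` is a certificate for proposing `b` in superview `k`; its rank is `ρ`. -/
def Justifies (k : ℕ) (σ : Sig n 2 2) (b : Fin 2) (ρ : ℕ) : Prop :=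
  ((∃ v, σ = Sig.full 0 ⟨v, b⟩) ∧ ρ = 0) ∨ (σ = Sig.full 1 ⟨ρ, b⟩ ∧ ρ % 7 = 3 ∧ ρ < 7 * k)

/-- The leader may propose with certificate `σ`. -/
def Proposal (t k : ℕ) (h : List (Batch n 2 2)) (σ : Sig n 2 2) : Prop :=
  TopLock k h σ ∨ ((∀ ρ b, ¬ Lock k h ρ b) ∧
    ∃ b, σ = Sig.full 0 ⟨7 * k, b⟩ ∧ Combinable t h 0 ⟨7 * k, b⟩)

/-- The leader of superview `k` has proposed `b`, with a certificate at least as high as all that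
were known when the superview started. -/
def Votable (t k : ℕ) (h : List (Batch n 2 2)) (b : Fin 2) : Prop :=
  ∃ B ∈ h, ∃ x ∈ B.inbox, Leads t x.1 k ∧ x.2.view = 7 * k + 2 ∧
    ∃ σ ∈ x.2.word.sigs, ∃ ρ, Justifies k σ b ρ ∧ ∀ ρ' b', Lock k (early k h) ρ' b' → ρ' ≤ ρ

/-- The signatures that `p` may send in view `v`, other than in requests. -/
def Emits (t : ℕ) (p : Fin n) (h : List (Batch n 2 2)) (v : ℕ) (σ : Sig n 2 2) : Prop :=
  (v % 7 = 1 ∧ σ ∈ receivedSigs h ∧ IsCommit σ) ∨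
  (v % 7 = 2 ∧ Proposal t (v / 7) h σ) ∨
  (v % 7 = 3 ∧ ∃ b, σ = Sig.share 1 p ⟨v, b⟩ ∧ Votable t (v / 7) h b) ∨
  (v % 7 = 4 ∧ ∃ b, σ = Sig.full 1 ⟨v - 1, b⟩ ∧ Combinable t h 1 ⟨v - 1, b⟩) ∨
  (v % 7 = 5 ∧ ∃ b, σ = Sig.share 1 p ⟨v, b⟩ ∧ Sig.full 1 ⟨v - 2, b⟩ ∈ receivedSigs h) ∨
  (v % 7 = 6 ∧ IsCommit σ ∧
    (σ ∈ receivedSigs h ∨ ∃ b, σ = Sig.full 1 ⟨v - 1, b⟩ ∧ Combinable t h 1 ⟨v - 1, b⟩))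

/-- The parties to which `p` sends in view `v`, other than requests. -/
def Recipient (t : ℕ) (p : Fin n) (h : List (Batch n 2 2)) (v : ℕ) (q : Fin n) : Prop :=
  (v % 7 = 1 ∧ Answers t p q h) ∨
  (v % 7 ≠ 1 ∧ ¬ HasDecision (v / 7) h ∧
    ((Leads t p (v / 7) ∧ q.val < 3 * t + 1 ∧ v % 7 % 2 = 0) ∨
      (p.val < 3 * t + 1 ∧ Leads t q (v / 7) ∧ v % 7 % 2 = 1)))

/-- The encoding of inputs. -/
def encode (b : Bool) : Fin 2 := if b then 1 else 0

/-- A request carries the input of a committee member, and its highest vote certificate. -/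
noncomputable def request (t : ℕ) (p : Fin n) (b : Bool) (h : List (Batch n 2 2)) (v : ℕ) :
    Word n 2 2 where
  body := 0
  sigs := (if p.val < 3 * t + 1 then [Sig.share 0 p ⟨v, encode b⟩] else []) ++
    pick (TopLock (v / 7) (early (v / 7) h))
  size := by
    have := length_pick_le (TopLock (v / 7) (early (v / 7) h))
    rw [List.length_append]
    split_ifs <;> simp <;> omega

/-- The word with the signature `σ`. -/
def certWord (σ : Sig n 2 2) : Word n 2 2 := ⟨0, [σ], by simp⟩

/-- The words that `p` sends when it enters view `v`. -/
noncomputable def act (t : ℕ) (p : Fin n) (b : Bool) (h : List (Batch n 2 2)) (v : ℕ) :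
    List (Fin n × Word n 2 2) :=
  if v % 7 = 0 then
    if HasDecision (v / 7) h then [] else
      ((List.finRange n).filter fun q => Target t p q (v / 7)).map fun q => (q, request t p b h v)
  else
    (pick (Emits t p h v)).flatMap fun σ =>
      ((List.finRange n).filter fun q => Recipient t p h v q).map fun q => (q, certWord σ)

theorem mem_act {t : ℕ} {p : Fin n} {b : Bool} {h : List (Batch n 2 2)} {v : ℕ}
    {q : Fin n} {w : Word n 2 2} :
    (q, w) ∈ act t p b h v ↔
      (v % 7 = 0 ∧ ¬ HasDecision (v / 7) h ∧ Target t p q (v / 7) ∧ w = request t p b h v) ∨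
      (v % 7 ≠ 0 ∧ Recipient t p h v q ∧ ∃ σ ∈ pick (Emits t p h v), w = certWord σ) := by
  unfold act
  split_ifs with h1 h2
  · simp [h1, h2]
  · simp only [h1, h2, List.mem_map, List.mem_filter, List.mem_finRange, true_and, decide_eq_true_eq,
      Prod.mk.injEq, not_false_eq_true, ne_eq, not_true_eq_false, false_and, or_false]
    constructor
    · rintro ⟨a, ha, rfl, rfl⟩
      exact ⟨ha, rfl⟩
    · rintro ⟨ha, rfl⟩
      exact ⟨q, ha, rfl, rfl⟩
  · simp only [h1, List.mem_flatMap, List.mem_map, List.mem_filter, List.mem_finRange, true_and,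
      decide_eq_true_eq, Prod.mk.injEq, false_and, false_or, ne_eq, not_false_eq_true]
    constructor
    · rintro ⟨σ, hσ, a, ha, rfl, rfl⟩
      exact ⟨ha, σ, hσ, rfl⟩
    · rintro ⟨ha, σ, hσ, rfl⟩
      exact ⟨σ, hσ, q, ha, rfl, rfl⟩

theorem receivedSigs_mono {h h' : List (Batch n 2 2)} (hh : ∀ B ∈ h, B ∈ h') :
    receivedSigs h ⊆ receivedSigs h' := by
  rintro σ ⟨B, hB, hσ⟩
  exact ⟨B, hh B hB, hσ⟩

theorem receivedSigs_early {k : ℕ} {h : List (Batch n 2 2)} :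
    receivedSigs (early k h) ⊆ receivedSigs h :=
  receivedSigs_mono fun _ hB => (List.mem_filter.1 hB).1

theorem TopLock.mem {k : ℕ} {h : List (Batch n 2 2)} {σ : Sig n 2 2} (hσ : TopLock k h σ) :
    σ ∈ receivedSigs h := by
  obtain ⟨ρ, b, rfl, hl, -⟩ := hσ
  exact hl.1

/-- Serves twice: it shows that the protocol sends only what it can derive, and it is the induction
step of unforgeability in `legit`. -/
theorem sigs_of_mem_act {t : ℕ} {p : Fin n} {b : Bool} {h : List (Batch n 2 2)} {v : ℕ}
    {x : Fin n × Word n 2 2} (hx : x ∈ act t p b h v) {σ : Sig n 2 2} (hσ : σ ∈ x.2.sigs) :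
    (p.val < 3 * t + 1 ∧ ∃ i a, σ = Sig.share i p ⟨v, a⟩) ∨ σ ∈ receivedSigs h ∨
      ∃ i m, σ = Sig.full i m ∧ Combinable t h i m := by
  obtain ⟨q, w⟩ := x
  rcases mem_act.1 hx with ⟨-, -, -, rfl⟩ | ⟨h0, hr, τ, hτ, rfl⟩
  · simp only [request, List.mem_append] at hσ
    rcases hσ with hσ | hσ
    · split_ifs at hσ with hp
      · exact Or.inl ⟨hp, 0, _, List.mem_singleton.1 hσ⟩
      · simp at hσ
    · exact Or.inr (Or.inl (receivedSigs_early (of_mem_pick hσ).mem))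
  · obtain rfl := List.mem_singleton.1 hσ
    have hp : v % 7 % 2 = 1 → v % 7 ≠ 1 → p.val < 3 * t + 1 := by
      intro h1 h2
      rcases hr with hr | ⟨-, -, ⟨-, -, hr⟩ | hr⟩
      · omega
      · omega
      · exact hr.1
    rcases of_mem_pick hτ with ⟨-, h1, -⟩ | ⟨-, h1 | ⟨-, a, h1, h2⟩⟩ | ⟨hv, a, h1, -⟩ |
      ⟨-, a, h1, h2⟩ | ⟨hv, a, h1, -⟩ | ⟨-, -, h1 | ⟨a, h1, h2⟩⟩
    · exact Or.inr (Or.inl h1)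
    · exact Or.inr (Or.inl h1.mem)
    · exact Or.inr (Or.inr ⟨_, _, h1, h2⟩)
    · exact Or.inl ⟨hp (by omega) (by omega), _, _, h1⟩
    · exact Or.inr (Or.inr ⟨_, _, h1, h2⟩)
    · exact Or.inl ⟨hp (by omega) (by omega), _, _, h1⟩
    · exact Or.inr (Or.inl h1)
    · exact Or.inr (Or.inr ⟨_, _, h1, h2⟩)

/-- The protocol. -/
noncomputable def protocol (t n : ℕ) : Protocol n 2 2 where
  schemes := schemes t n
  send p b h :=
    match h with
    | [] => []
    | B :: tl => if ∀ B' ∈ tl, B'.view < B.view then act t p b (B :: tl) B.view else []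
  decide _ _ h :=
    if ∃ j, Sig.full 1 ⟨7 * j + 5, 1⟩ ∈ receivedSigs h then some true
    else if ∃ j, Sig.full 1 ⟨7 * j + 5, 0⟩ ∈ receivedSigs h then some false
    else none
  send_derivable p b h x hx σ hσ := by
    rcases h with _ | ⟨B, tl⟩
    · simp at hx
    · dsimp only at hx
      split_ifs at hx with hB
      · rcases sigs_of_mem_act hx hσ with ⟨hp, i, a, rfl⟩ | h1 | ⟨i, m, rfl, A, hA, hcard, hsh⟩
        · exact Derivable.tsign ⟨rfl, B, List.mem_cons_self, rfl⟩
            (Finset.mem_filter.2 ⟨Finset.mem_univ _, hp⟩)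
        · exact Derivable.known h1
        · exact Derivable.tcombine A hA hcard fun q hq => Derivable.known (hsh q hq)
      · simp at hx

/-- The assumptions on a run. -/
structure Admissible (t Δ GST : ℕ) (R : Run n 2 2) : Prop where
  resilience : 3 * t < n
  delay_pos : 0 < Δ
  numFaulty_le : R.numFaulty ≤ t
  exec : R.IsExecution (protocol t n)
  sync : R.PartiallySynchronous (protocol t n) Δ GST
  views : R.ViewsSynchronized (2 * Δ) GST

/-! ### The protocol as seen in a run. -/

section Runs

variable {t Δ GST : ℕ} {R : Run n 2 2}

theorem fresh_hist_iff {p : Fin n} {τ v : ℕ} (ha : R.Active p τ) :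
    Fresh (R.hist p τ) v ↔ R.view p τ = v ∧ ∀ s < τ, R.Active p s → R.view p s < v := by
  obtain ⟨tl, h1, h2⟩ := Run.hist_eq_cons ha
  constructor
  · rintro ⟨B, tl', he, rfl, hB⟩
    rw [h1] at he
    injection he with he1 he2
    subst he1 he2
    exact ⟨rfl, fun s hs has => hB _ ((h2 _).2 ⟨s, hs, has, rfl⟩)⟩
  · rintro ⟨rfl, h⟩
    refine ⟨_, tl, h1, rfl, fun B hB => ?_⟩
    obtain ⟨s, hs, has, rfl⟩ := (h2 B).1 hB
    exact h s hs has

/-- A view change is itself an activation, so the view is constant between activations. Hence the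
freshness test on the recorded history detects true entries. -/
theorem enters_of_active_lt {p : Fin n} {τ : ℕ}
    (h : ∀ s < τ, R.Active p s → R.view p s < R.view p τ) : R.Enters p τ := by
  intro s hs
  induction s with
  | zero => exact h 0 hs trivial
  | succ s ih =>
    by_cases ha : R.Active p (s + 1)
    · exact h _ hs ha
    · have : R.view p (s + 1) = R.view p s := by
        by_contra hc
        exact ha (Or.inl hc)
      rw [this]
      exact ih (by omega)

theorem fresh_hist {p : Fin n} {τ v : ℕ} (ha : R.Active p τ) :
    Fresh (R.hist p τ) v ↔ R.view p τ = v ∧ R.Enters p τ := by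
  rw [fresh_hist_iff ha]
  constructor
  · rintro ⟨rfl, h⟩
    exact ⟨rfl, enters_of_active_lt h⟩
  · rintro ⟨rfl, h⟩
    exact ⟨rfl, fun s hs _ => h s hs⟩

theorem sent_eq {p : Fin n} {τ : ℕ} :
    R.sent (protocol t n) p τ =
      if R.Enters p τ then act t p (R.input p) (R.hist p τ) (R.view p τ) else [] := by
  unfold Run.sent
  by_cases ha : R.Active p τ
  · rw [if_pos ha]
    obtain ⟨tl, h1, h2⟩ := Run.hist_eq_cons ha
    rw [h1]
    simp only [protocol]
    refine if_congr ⟨fun h => ?_, fun h B hB => ?_⟩ rfl rfl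
    · exact enters_of_active_lt fun s hs has => h _ ((h2 _).2 ⟨s, hs, has, rfl⟩)
    · obtain ⟨s, hs, has, rfl⟩ := (h2 B).1 hB
      exact h s hs
  · rw [if_neg ha, if_neg fun h => ha h.active]

theorem mem_sent {p : Fin n} {τ : ℕ} {x : Fin n × Word n 2 2} :
    x ∈ R.sent (protocol t n) p τ ↔
      R.Enters p τ ∧ x ∈ act t p (R.input p) (R.hist p τ) (R.view p τ) := by
  rw [sent_eq]
  split_ifs with h <;> simp [h]

theorem mem_early_hist {p : Fin n} {k τ : ℕ} {σ : Sig n 2 2} :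
    σ ∈ receivedSigs (early k (R.hist p τ)) ↔
      ∃ s ≤ τ, R.view p s < 7 * k ∧ ∃ x ∈ R.inbox p s, σ ∈ x.2.word.sigs := by
  constructor
  · rintro ⟨B, hB, x, hx, hσ⟩
    obtain ⟨hB, hv⟩ := List.mem_filter.1 hB
    obtain ⟨s, hs, -, rfl⟩ := Run.mem_hist_iff.1 hB
    exact ⟨s, hs, of_decide_eq_true hv, x, hx, hσ⟩
  · rintro ⟨s, hs, hv, x, hx, hσ⟩
    exact ⟨_, List.mem_filter.2 ⟨Run.mem_hist_iff.2 ⟨s, hs, Run.active_of_mem_inbox hx, rfl⟩,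
      decide_eq_true hv⟩, x, hx, hσ⟩

/-- Before view `v`, party `p` has received a commit certificate. -/
def Knows (R : Run n 2 2) (p : Fin n) (v : ℕ) : Prop :=
  ∃ s, R.view p s < v ∧ ∃ x ∈ R.inbox p s, ∃ σ ∈ x.2.word.sigs, IsCommit σ

theorem Knows.mono {p : Fin n} {v v' : ℕ} (h : Knows R p v) (hv : v ≤ v') : Knows R p v' := by
  obtain ⟨s, hs, h⟩ := h
  exact ⟨s, by omega, h⟩

/-- Only packets received in views below `7 * k` count, so the answer is frozen once superview `k`
starts and no longer depends on the tick. This is what allows words to be charged to whole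
superviews. -/
theorem hasDecision_hist {p : Fin n} {k τ : ℕ} (hm : Monotone (R.view p))
    (hk : 7 * k ≤ R.view p τ) : HasDecision k (R.hist p τ) ↔ Knows R p (7 * k) := by
  constructor
  · rintro ⟨σ, hσ, hc⟩
    obtain ⟨s, -, hs, x, hx, hσ⟩ := mem_early_hist.1 hσ
    exact ⟨s, hs, x, hx, σ, hσ, hc⟩
  · rintro ⟨s, hs, x, hx, σ, hσ, hc⟩
    refine ⟨σ, mem_early_hist.2 ⟨s, ?_, hs, x, hx, hσ⟩, hc⟩
    by_contra hlt
    exact absurd (hm (not_le.1 hlt).le) (by omega)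

end Runs

end CommitteeBA

/-! ### Safety: unforgeability, quorum intersection, agreement and unanimity. -/

namespace CommitteeBA

variable {n t Δ GST : ℕ} {R : Run n 2 2}

/-- Party `p` has sent its share of scheme `i` on `m`. -/
def Shared (t : ℕ) (R : Run n 2 2) (i : Fin 2) (p : Fin n) (m : Stmt 2) : Prop :=
  ∃ s, ∃ x ∈ R.sent (protocol t n) p s, Sig.share i p m ∈ x.2.sigs

/-- Shares of honest parties have been sent by them, and certificates stem from a full set of
such shares. -/
def Legit (t : ℕ) (R : Run n 2 2) : Sig n 2 2 → Prop
  | Sig.single _ _ => True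
  | Sig.share i p m => R.Honest p → Shared t R i p m
  | Sig.full i m => ∃ A ⊆ committee t n, A.card = (schemes t n i).threshold ∧
      ∀ p ∈ A, R.Honest p → Shared t R i p m

theorem legit_of_derivable {canSign : Fin n → Stmt 2 → Prop} {known : Set (Sig n 2 2)}
    (hc : ∀ p m, canSign p m → ¬ R.Honest p) (hk : ∀ σ ∈ known, Legit t R σ) {σ : Sig n 2 2}
    (h : Derivable (schemes t n) canSign known σ) : Legit t R σ := by
  induction h with
  | known h => exact hk _ h
  | sign h => trivial
  | tsign h _ => exact fun hp => absurd hp (hc _ _ h)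
  | tcombine A hA hcard _ ih => exact ⟨A, hA, hcard, ih⟩

/-- What it means that `p` has sent a share. -/
theorem Shared.spec {p : Fin n} {i : Fin 2} {m : Stmt 2}
    (h : Shared t R i p m) :
    ∃ s, R.Enters p s ∧ R.view p s = m.view ∧
      ((i = 0 ∧ m.body = encode (R.input p)) ∨
        (i = 1 ∧ m.view % 7 ≠ 0 ∧
          Sig.share i p m ∈ pick (Emits t p (R.hist p s) m.view))) := by
  obtain ⟨s, ⟨q, w⟩, hy, hσ⟩ := h
  obtain ⟨hent, hy⟩ := mem_sent.1 hy
  have hnot : ∀ {h : List (Batch n 2 2)} {k σ}, σ ∈ pick (TopLock k h) →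
      σ ≠ Sig.share i p m := by
    rintro h k σ hσ rfl
    obtain ⟨ρ, b, h, -⟩ := of_mem_pick hσ
    cases h
  refine ⟨s, hent, ?_⟩
  rcases mem_act.1 hy with ⟨-, -, -, rfl⟩ | ⟨h0, hr, τ, hτ, rfl⟩
  · simp only [request, List.mem_append] at hσ
    rcases hσ with hσ | hσ
    · split_ifs at hσ with hp
      · have := List.mem_singleton.1 hσ
        cases this
        exact ⟨rfl, Or.inl ⟨rfl, rfl⟩⟩
      · simp at hσ
    · exact absurd rfl (hnot hσ)
  · obtain rfl := List.mem_singleton.1 hσ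
    have hv : i = 1 ∧ R.view p s = m.view := by
      rcases of_mem_pick hτ with ⟨-, -, _, _, h1⟩ | ⟨-, ⟨_, _, h1, -⟩ | ⟨-, a, h1, h2⟩⟩ |
        ⟨hv, a, h1, -⟩ | ⟨-, a, h1, h2⟩ | ⟨hv, a, h1, -⟩ | ⟨-, ⟨_, _, h1⟩, -⟩ <;> cases h1
      · exact ⟨rfl, rfl⟩
      · exact ⟨rfl, rfl⟩
    refine ⟨hv.2, Or.inr ⟨hv.1, ?_, ?_⟩⟩
    · rwa [← hv.2]
    · rwa [← hv.2]

namespace Admissible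

/-- Signatures are unforgeable. -/
theorem legit (H : Admissible t Δ GST R) {q : Fin n} {τ : ℕ} {x : Fin n × Packet n 2 2}
    (hx : x ∈ R.inbox q τ) {σ : Sig n 2 2} (hσ : σ ∈ x.2.word.sigs) : Legit t R σ := by
  induction τ using Nat.strong_induction_on generalizing q x σ with
  | _ τ ih =>
    -- Whatever is used at `τ` was sent strictly earlier, and so rests on packets delivered before
    -- `τ`.
    have hsent : ∀ p s, s < τ → ∀ y ∈ R.sent (protocol t n) p s, ∀ σ ∈ y.2.sigs,
        Legit t R σ := by
      intro p s hs y hy σ hσ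
      have hrec : ∀ σ ∈ receivedSigs (R.hist p s), Legit t R σ := by
        intro σ hσ
        obtain ⟨s', hs', z, hz, hσ⟩ := Run.mem_receivedSigs_hist.1 hσ
        exact ih s' (by omega) hz hσ
      rcases sigs_of_mem_act (mem_sent.1 hy).2 hσ with
        ⟨-, i, a, rfl⟩ | h | ⟨i, m, rfl, A, hA, hcard, hsh⟩
      · exact fun _ => ⟨s, y, hy, hσ⟩
      · exact hrec _ h
      · exact ⟨A, hA, hcard, fun p hp => hrec _ (hsh p hp)⟩
    obtain ⟨p, k⟩ := x
    rcases H.exec q τ p k hx with ⟨s, w, hs, -, hw, rfl⟩ | ⟨-, h⟩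
    · exact hsent p s hs _ hw σ hσ
    · refine legit_of_derivable (fun p _ hp hh => hp (hh.uncorrupted τ)) ?_ (h σ hσ)
      rintro σ ⟨p', s, hs, -, y, hy, hσ⟩
      exact hsent p' s hs y hy σ hσ

theorem card_committee (H : Admissible t Δ GST R) : (committee t n).card = 3 * t + 1 := by
  rw [committee, Fin.card_filter_val_lt]
  have := H.resilience
  omega

theorem exists_honest (H : Admissible t Δ GST R) {A : Finset (Fin n)} (hA : t < A.card) :
    ∃ p ∈ A, R.Honest p := by
  by_contra! hc
  have : A.card ≤ R.numFaulty :=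
    Finset.card_le_card fun p hp => Finset.mem_filter.2 ⟨Finset.mem_univ _, hc p hp⟩
  have := H.numFaulty_le
  omega

/-- Two sets of 2t+1 among 3t+1 members overlap in at least t+1, more than can be faulty. -/
theorem exists_honest_inter (H : Admissible t Δ GST R) {A B : Finset (Fin n)}
    (hA : A ⊆ committee t n) (hB : B ⊆ committee t n) (hAc : A.card = 2 * t + 1)
    (hBc : B.card = 2 * t + 1) : ∃ p, p ∈ A ∧ p ∈ B ∧ R.Honest p := by
  have h1 := Finset.card_union_add_card_inter A B
  have h2 := (Finset.card_le_card (Finset.union_subset hA hB)).trans_eq H.card_committee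
  obtain ⟨p, hp, hh⟩ := H.exists_honest (A := A ∩ B) (by omega)
  exact ⟨p, (Finset.mem_inter.1 hp).1, (Finset.mem_inter.1 hp).2, hh⟩

theorem le_card_honest (H : Admissible t Δ GST R) :
    2 * t + 1 ≤ ((committee t n).filter fun p => R.Honest p).card := by
  have h1 := Finset.card_filter_add_card_filter_not (s := committee t n) (fun p => R.Honest p)
  have h2 : ((committee t n).filter fun p => ¬ R.Honest p).card ≤ R.numFaulty :=
    Finset.card_le_card (Finset.filter_subset_filter _ (Finset.subset_univ _))
  have := H.numFaulty_le
  have := H.card_committee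
  omega

theorem shared_vote {p : Fin n} {k : ℕ} {b : Fin 2}
    (h : Shared t R 1 p ⟨7 * k + 3, b⟩) :
    ∃ s, R.view p s = 7 * k + 3 ∧ Votable t k (R.hist p s) b := by
  obtain ⟨s, -, hv, ⟨h, -⟩ | ⟨-, -, h⟩⟩ := h.spec
  · simp at h
  · refine ⟨s, hv, ?_⟩
    simp only at h
    rcases of_mem_pick h with ⟨h, -⟩ | ⟨h, -⟩ | ⟨h, a, h1, h2⟩ | ⟨h, -⟩ | ⟨h, -⟩ | ⟨h, -⟩
    all_goals first | omega | skip
    cases h1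
    rwa [show (7 * k + 3) / 7 = k by omega] at h2

theorem shared_commit {p : Fin n} {k : ℕ} {b : Fin 2}
    (h : Shared t R 1 p ⟨7 * k + 5, b⟩) :
    ∃ s, R.view p s = 7 * k + 5 ∧ Sig.full 1 ⟨7 * k + 3, b⟩ ∈ receivedSigs (R.hist p s) := by
  obtain ⟨s, -, hv, ⟨h, -⟩ | ⟨-, -, h⟩⟩ := h.spec
  · simp at h
  · refine ⟨s, hv, ?_⟩
    simp only at h
    rcases of_mem_pick h with ⟨h, -⟩ | ⟨h, -⟩ | ⟨h, -⟩ | ⟨h, -⟩ | ⟨h, a, h1, h2⟩ | ⟨h, -⟩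
    all_goals first | omega | skip
    cases h1
    exact h2

/-- A view is entered at one tick only, and `pick` yields a single signature there. -/
theorem shared_unique {p : Fin n} {v : ℕ} {b b' : Fin 2}
    (h : Shared t R 1 p ⟨v, b⟩) (h' : Shared t R 1 p ⟨v, b'⟩) : b = b' := by
  obtain ⟨s, he, hv, ⟨h, -⟩ | ⟨-, -, h⟩⟩ := h.spec
  · simp at h
  obtain ⟨s', he', hv', ⟨h', -⟩ | ⟨-, -, h'⟩⟩ := h'.spec
  · simp at h'
  obtain rfl := he.eq_of_view_eq he' (hv.trans hv'.symm)
  have := eq_of_mem_pick h h'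
  cases this
  rfl

end Admissible

/-- The certificate of scheme `i` on `m` has been received by some party. -/
def Exists (R : Run n 2 2) (i : Fin 2) (m : Stmt 2) : Prop :=
  ∃ q τ, ∃ x ∈ R.inbox q τ, Sig.full i m ∈ x.2.word.sigs

theorem Exists.of_hist {p : Fin n} {τ : ℕ} {i : Fin 2} {m : Stmt 2}
    (h : Sig.full i m ∈ receivedSigs (R.hist p τ)) : Exists R i m := by
  obtain ⟨s, -, x, hx, hσ⟩ := Run.mem_receivedSigs_hist.1 h
  exact ⟨p, s, x, hx, hσ⟩

namespace Admissible

theorem quorum (H : Admissible t Δ GST R) {m : Stmt 2} (h : Exists R 1 m) :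
    ∃ A ⊆ committee t n, A.card = 2 * t + 1 ∧ ∀ p ∈ A, R.Honest p → Shared t R 1 p m := by
  obtain ⟨q, τ, x, hx, hσ⟩ := h
  obtain ⟨A, hA, hc, h⟩ := H.legit hx hσ
  exact ⟨A, hA, by simpa [schemes] using hc, h⟩

theorem exists_shared (H : Admissible t Δ GST R) {i : Fin 2} {m : Stmt 2} (h : Exists R i m) :
    ∃ p, R.Honest p ∧ Shared t R i p m := by
  obtain ⟨q, τ, x, hx, hσ⟩ := h
  obtain ⟨A, hA, hc, h⟩ := H.legit hx hσ
  obtain ⟨p, hp, hh⟩ := H.exists_honest (A := A) (by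
    rw [hc, schemes]
    dsimp only
    split_ifs <;> omega)
  exact ⟨p, hh, h p hp hh⟩

theorem cert_unique (H : Admissible t Δ GST R) {v : ℕ} {b b' : Fin 2}
    (h : Exists R 1 ⟨v, b⟩) (h' : Exists R 1 ⟨v, b'⟩) : b = b' := by
  obtain ⟨A, hA, hAc, hAs⟩ := H.quorum h
  obtain ⟨B, hB, hBc, hBs⟩ := H.quorum h'
  obtain ⟨p, hpA, hpB, hp⟩ := H.exists_honest_inter hA hB hAc hBc
  exact shared_unique (hAs p hpA hp) (hBs p hpB hp)

theorem vote_of_commit (H : Admissible t Δ GST R) {k : ℕ} {b : Fin 2}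
    (h : Exists R 1 ⟨7 * k + 5, b⟩) : Exists R 1 ⟨7 * k + 3, b⟩ := by
  obtain ⟨p, -, h⟩ := H.exists_shared h
  obtain ⟨s, -, h⟩ := shared_commit h
  exact Exists.of_hist h

/-- A common honest member of the two quorums held the vote certificate of superview `k` before
voting in `k'`. It then voted only for a proposal justified by a certificate of at least that rank,
which comes from a superview between `k` and `k'`, where induction applies. -/
theorem vote_after_commit (H : Admissible t Δ GST R) {k k' : ℕ} {b b' : Fin 2}
    (h : Exists R 1 ⟨7 * k + 5, b⟩) (h' : Exists R 1 ⟨7 * k' + 3, b'⟩) (hk : k ≤ k') :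
    b' = b := by
  induction k' using Nat.strong_induction_on with
  | _ k' ih =>
    rcases Nat.lt_or_eq_of_le hk with hk | rfl
    · obtain ⟨A, hA, hAc, hAs⟩ := H.quorum h
      obtain ⟨B, hB, hBc, hBs⟩ := H.quorum h'
      obtain ⟨p, hpA, hpB, hp⟩ := H.exists_honest_inter hA hB hAc hBc
      obtain ⟨s, hs, hcert⟩ := shared_commit (hAs p hpA hp)
      obtain ⟨s', hs', C, hC, x, hx, -, -, σ, hσ, ρ, hj, htop⟩ := shared_vote (hBs p hpB hp)
      have hlock : Lock k' (early k' (R.hist p s')) (7 * k + 3) b := by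
        refine ⟨?_, by omega, by omega⟩
        obtain ⟨a, ha, y, hy, hyσ⟩ := Run.mem_receivedSigs_hist.1 hcert
        have hva := H.views.mono p ha
        refine mem_early_hist.2 ⟨a, ?_, by omega, y, hy, hyσ⟩
        by_contra hlt
        exact absurd (H.views.mono p (not_le.1 hlt).le) (by omega)
      have hρ := htop _ _ hlock
      rcases hj with ⟨-, rfl⟩ | ⟨rfl, h1, h2⟩
      -- Input certificates have rank `0`, below the lock `7 * k + 3`.
      · omega
      · obtain ⟨j, rfl⟩ : ∃ j, ρ = 7 * j + 3 := ⟨ρ / 7, by omega⟩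
        exact ih j (by omega) (Exists.of_hist ⟨C, hC, x, hx, hσ⟩) (by omega)
    · exact H.cert_unique h' (H.vote_of_commit h)

theorem commit_unique (H : Admissible t Δ GST R) {k k' : ℕ} {b b' : Fin 2}
    (h : Exists R 1 ⟨7 * k + 5, b⟩) (h' : Exists R 1 ⟨7 * k' + 5, b'⟩) : b = b' := by
  rcases le_total k k' with hk | hk
  · exact (H.vote_after_commit h (H.vote_of_commit h') hk).symm
  · exact H.vote_after_commit h' (H.vote_of_commit h) hk

/-- Justifying certificates come from ever earlier superviews, so the chain ends in an input
certificate; of its t+1 signers one is honest. -/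
theorem input_of_vote (H : Admissible t Δ GST R) {k : ℕ} {b : Fin 2}
    (h : Exists R 1 ⟨7 * k + 3, b⟩) : ∃ p, R.Honest p ∧ encode (R.input p) = b := by
  induction k using Nat.strong_induction_on with
  | _ k ih =>
    obtain ⟨p, -, hp⟩ := H.exists_shared h
    obtain ⟨s, hs, C, hC, x, hx, -, -, σ, hσ, ρ, hj, -⟩ := shared_vote hp
    rcases hj with ⟨⟨v, rfl⟩, -⟩ | ⟨rfl, h1, h2⟩
    · obtain ⟨q, hq, hs⟩ := H.exists_shared (Exists.of_hist ⟨C, hC, x, hx, hσ⟩)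
      obtain ⟨-, -, -, ⟨-, h⟩ | ⟨h, -⟩⟩ := hs.spec
      · exact ⟨q, hq, h.symm⟩
      · simp at h
    · obtain ⟨j, rfl⟩ : ∃ j, ρ = 7 * j + 3 := ⟨ρ / 7, by omega⟩
      exact ih j (by omega) (Exists.of_hist ⟨C, hC, x, hx, hσ⟩)

/-- The order in which `decide` tests the two values is immaterial, since commit certificates for
both cannot exist. -/
theorem decided_iff (H : Admissible t Δ GST R) {p : Fin n} {τ : ℕ} {v : Bool} :
    R.Decided (protocol t n) p τ v ↔
      ∃ j, Sig.full 1 ⟨7 * j + 5, encode v⟩ ∈ receivedSigs (R.hist p τ) := by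
  unfold Run.Decided
  simp only [protocol]
  split_ifs with h1 h0
  · cases v
    · simp only [Option.some.injEq, Bool.true_eq_false, false_iff]
      rintro ⟨j, hj⟩
      obtain ⟨j', hj'⟩ := h1
      have := H.commit_unique (Exists.of_hist hj) (Exists.of_hist hj')
      simp [encode] at this
    · simpa [encode] using h1
  · cases v
    · simpa [encode] using h0
    · simpa [encode] using h1
  · cases v
    · simpa [encode] using h0
    · simpa [encode] using h1

theorem agreement (H : Admissible t Δ GST R) : R.Agreement (protocol t n) := by
  intro p q τ τ' v v' _ _ h h'
  obtain ⟨j, hj⟩ := H.decided_iff.1 h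
  obtain ⟨j', hj'⟩ := H.decided_iff.1 h'
  have := H.commit_unique (Exists.of_hist hj) (Exists.of_hist hj')
  cases v <;> cases v' <;> simp_all [encode]

theorem strongUnanimity_of_termination (H : Admissible t Δ GST R)
    (hT : R.Termination (protocol t n)) : R.StrongUnanimity (protocol t n) := by
  intro v hv p hp
  obtain ⟨τ, w, hw⟩ := hT p hp
  obtain ⟨j, hj⟩ := H.decided_iff.1 hw
  obtain ⟨q, hq, hin⟩ := H.input_of_vote (H.vote_of_commit (Exists.of_hist hj))
  rw [hv q hq] at hin
  have : v = w := by cases v <;> cases w <;> simp_all [encode]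
  exact ⟨τ, this ▸ hw⟩

end Admissible

/-! ### Liveness: superviews with an honest leader. -/

/-- No party that is uncorrupted at `GST` has reached view `v` by then. -/
def Clean (R : Run n 2 2) (GST v : ℕ) : Prop :=
  ∀ q, R.Uncorrupted q GST → R.view q GST < v

theorem Clean.mono {v v' : ℕ} (h : Clean R GST v) (hv : v ≤ v') : Clean R GST v' :=
  fun q hq => (h q hq).trans_le hv

theorem exists_topLock {k ρ : ℕ} {h : List (Batch n 2 2)} {b : Fin 2} (hl : Lock k h ρ b) :
    ∃ ρ' b', ρ ≤ ρ' ∧ TopLock k h (Sig.full 1 ⟨ρ', b'⟩) ∧ Lock k h ρ' b' := by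
  have hP : ∃ b, Lock k h ρ b := ⟨b, hl⟩
  have hle : ∀ ρ' b', Lock k h ρ' b' → ρ' ≤ 7 * k := fun ρ' b' h => h.2.2.le
  obtain ⟨b', hb'⟩ := Nat.findGreatest_spec (P := fun ρ => ∃ b, Lock k h ρ b) (hle _ _ hl) hP
  refine ⟨_, b', Nat.le_findGreatest (hle _ _ hl) hP, ⟨_, b', rfl, hb', fun ρ' b'' h' => ?_⟩, hb'⟩
  exact Nat.le_findGreatest (hle _ _ h') ⟨b'', h'⟩

theorem Leads.unique {p q : Fin n} {k : ℕ} (hp : Leads t p k) (hq : Leads t q k) : p = q :=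
  Fin.ext (hp.2.trans hq.2.symm)

theorem Leads.lt {p : Fin n} {k : ℕ} (hp : Leads t p k) : k % (3 * t + 3) < 3 * t + 1 :=
  hp.2 ▸ hp.1

theorem Leads.target_left {p q : Fin n} {k : ℕ} (hp : Leads t p k) (hq : q.val < 3 * t + 1) :
    Target t p q k :=
  Or.inl ⟨hp.1, hq, hp.lt, Or.inl hp.2⟩

theorem Leads.target_right {p q : Fin n} {k : ℕ} (hp : Leads t p k) (hq : q.val < 3 * t + 1) :
    Target t q p k :=
  Or.inl ⟨hq, hp.1, hp.lt, Or.inr hp.2⟩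

namespace Admissible

theorem receive (H : Admissible t Δ GST R) {p q : Fin n} {s τ v : ℕ} {w : Word n 2 2}
    (hC : Clean R GST v) (hp : R.Uncorrupted p s) (hw : (q, w) ∈ R.sent (protocol t n) p s)
    (hsv : R.view p s ≤ v) (hq : R.Uncorrupted q τ) (hτ : GST ≤ τ) (h : v < R.view q τ) :
    ∃ s' ≤ τ, R.view q s' ≤ v ∧ (p, ⟨R.view p s, w⟩) ∈ R.inbox q s' :=
  H.views.delivered H.sync H.delay_pos hp hw (mem_sent.1 hw).1 hsv
    (hC q (hq.mono hτ)) h hq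

theorem receive_sig (H : Admissible t Δ GST R) {p q : Fin n} {s τ v : ℕ} {w : Word n 2 2}
    (hC : Clean R GST v) (hp : R.Uncorrupted p s) (hw : (q, w) ∈ R.sent (protocol t n) p s)
    (hsv : R.view p s ≤ v) (hq : R.Uncorrupted q τ) (hτ : GST ≤ τ) (h : v < R.view q τ)
    {σ : Sig n 2 2} (hσ : σ ∈ w.sigs) : σ ∈ receivedSigs (R.hist q τ) := by
  obtain ⟨s', hs', -, hx⟩ := H.receive hC hp hw hsv hq hτ h
  exact Run.mem_receivedSigs_hist.2 ⟨s', hs', _, hx, hσ⟩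

theorem honest_enters (H : Admissible t Δ GST R) {p : Fin n} {v v' : ℕ} (hC : Clean R GST v)
    (hp : R.Honest p) (hv : v ≤ v') : ∃ s, GST ≤ s ∧ R.Enters p s ∧ R.view p s = v' := by
  obtain ⟨τ, hτ⟩ := H.views.unbounded p hp v'
  have := hC p (hp.uncorrupted _)
  obtain ⟨s, -, h1, h2, h3⟩ := H.views.exists_enters (by omega) hτ
  exact ⟨s, h1.le, h2, h3⟩

theorem sends_request (H : Admissible t Δ GST R) {p q : Fin n} {s k : ℕ} (hs : R.Enters p s)
    (hv : R.view p s = 7 * k) (hk : ¬ Knows R p (7 * k)) (hT : Target t p q k) :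
    (q, request t p (R.input p) (R.hist p s) (7 * k)) ∈ R.sent (protocol t n) p s := by
  refine mem_sent.2 ⟨hs, mem_act.2 (Or.inl ?_)⟩
  rw [hv, show 7 * k / 7 = k by omega, hasDecision_hist (H.views.mono p) hv.ge]
  exact ⟨by omega, hk, hT, rfl⟩

theorem sends_cert {p q : Fin n} {s v : ℕ} (hs : R.Enters p s)
    (hv : R.view p s = v) (h0 : v % 7 ≠ 0) (hr : Recipient t p (R.hist p s) v q) {σ : Sig n 2 2}
    (hσ : σ ∈ pick (Emits t p (R.hist p s) v)) :
    (q, certWord σ) ∈ R.sent (protocol t n) p s := by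
  refine mem_sent.2 ⟨hs, mem_act.2 (Or.inr ?_)⟩
  rw [hv]
  exact ⟨h0, hr, σ, hσ, rfl⟩

theorem recipient_of_leads (H : Admissible t Δ GST R) {p q : Fin n} {s k v : ℕ}
    (hs : R.view p s = v) (hv : v = 7 * k + 2 ∨ v = 7 * k + 4 ∨ v = 7 * k + 6)
    (hk : ¬ Knows R p (7 * k)) (hp : Leads t p k) (hq : q.val < 3 * t + 1) :
    Recipient t p (R.hist p s) v q := by
  have : v / 7 = k := by omega
  refine Or.inr ⟨by omega, ?_, Or.inl ⟨this ▸ hp, hq, by omega⟩⟩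
  rwa [this, hasDecision_hist (H.views.mono p) (by omega)]

theorem recipient_of_voter (H : Admissible t Δ GST R) {p q : Fin n} {s k v : ℕ}
    (hs : R.view p s = v) (hv : v = 7 * k + 3 ∨ v = 7 * k + 5)
    (hk : ¬ Knows R p (7 * k)) (hp : p.val < 3 * t + 1) (hq : Leads t q k) :
    Recipient t p (R.hist p s) v q := by
  have : v / 7 = k := by omega
  refine Or.inr ⟨by omega, ?_, Or.inr ⟨hp, this ▸ hq, by omega⟩⟩
  rwa [this, hasDecision_hist (H.views.mono p) (by omega)]

/-- An honest party that knows the decision gives it to a party that asks. -/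
theorem serve (H : Admissible t Δ GST R) {p q : Fin n} {k τ : ℕ} (hC : Clean R GST (7 * k))
    (hT : Target t q p k) (hp : R.Honest p) (hk : Knows R p (7 * k)) (hq : R.Uncorrupted q τ)
    (hτ : GST ≤ τ) (hv : 7 * k + 2 ≤ R.view q τ) : Knows R q (7 * k + 2) := by
  by_cases hqk : Knows R q (7 * k)
  · exact hqk.mono (by omega)
  have hqG := hC q (hq.mono hτ)
  obtain ⟨s0, hs0, -, hent, hv0⟩ := H.views.exists_enters hqG (show 7 * k ≤ R.view q τ by omega)
  obtain ⟨s1, hG1, hent1, hv1⟩ := H.honest_enters hC hp (show 7 * k ≤ 7 * k + 1 by omega)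
  obtain ⟨s', hs', -, hx⟩ := H.receive hC (hq.mono hs0) (H.sends_request hent hv0 hqk hT) hv0.le
    (hp.uncorrupted s1) hG1 (by omega)
  have hm := H.views.mono p
  -- Answers are given only once, so the relevant answer is the one to the first request, possibly
  -- from an earlier superview `k'` or before `GST`. It still arrives in time, because `receive`
  -- covers words sent in any view up to `7 * k + 1`.
  have hasked : ∃ s, s ≤ s1 ∧ R.Active p s ∧ Asked t p q (R.hist p s) := by
    refine ⟨s1, le_rfl, hent1.active, k, (fresh_hist hent1.active).2 ⟨hv1, hent1⟩,
      (hasDecision_hist hm (by omega)).2 hk, hT, ?_⟩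
    exact ⟨_, Run.mem_hist_iff.2 ⟨s', hs', Run.active_of_mem_inbox hx, rfl⟩, _, hx, rfl, hv0⟩
  obtain ⟨⟨hle, hact, hask⟩, hmin⟩ :=
    And.intro (Nat.find_spec hasked) (fun {m} => Nat.find_min hasked (m := m))
  generalize Nat.find hasked = s at *
  have hans : Answers t p q (R.hist p s) := by
    refine ⟨hask, fun h' hsuf hne hask' => ?_⟩
    rcases Run.eq_hist_of_suffix hsuf with rfl | ⟨a, ha, haa, rfl⟩
    · obtain ⟨_, ⟨_, _, h, -⟩, -⟩ := hask'
      simp at h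
    · have : a < s := lt_of_le_of_ne ha fun h => hne (h ▸ rfl)
      exact hmin this ⟨by omega, haa, hask'⟩
  obtain ⟨k', hfresh, hdec, -, -⟩ := hask
  obtain ⟨hvs, hents⟩ := (fresh_hist hact).1 hfresh
  have hvle : R.view p s ≤ 7 * k + 1 := hv1 ▸ hm hle
  obtain ⟨σ, hσ⟩ : ∃ σ, σ ∈ pick (Emits t p (R.hist p s) (7 * k' + 1)) := by
    obtain ⟨σ, hσ, hc⟩ := hdec
    exact exists_mem_pick ⟨σ, Or.inl ⟨by omega, receivedSigs_early hσ, hc⟩⟩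
  have hsent := sends_cert (q := q) hents hvs (by omega) (Or.inl ⟨by omega, hans⟩) hσ
  obtain ⟨a, -, hva, hxa⟩ := H.receive (hC.mono (by omega)) (hp.uncorrupted s) hsent hvle hq hτ
    (by omega)
  refine ⟨a, by omega, _, hxa, σ, by simp [certWord], ?_⟩
  rcases of_mem_pick hσ with ⟨-, -, h⟩ | ⟨h, -⟩ | ⟨h, -⟩ | ⟨h, -⟩ | ⟨h, -⟩ | ⟨h, -⟩
  · exact h
  all_goals omega

theorem combinable_vote (H : Admissible t Δ GST R) {h : List (Batch n 2 2)} {m : Stmt 2}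
    (hs : ∀ p : Fin n, p.val < 3 * t + 1 → R.Honest p → Sig.share 1 p m ∈ receivedSigs h) :
    Combinable t h 1 m := by
  obtain ⟨A, hA, hc⟩ := Finset.exists_subset_card_eq H.le_card_honest
  refine ⟨A, hA.trans (Finset.filter_subset _ _), by simpa [schemes] using hc, fun p hp => ?_⟩
  obtain ⟨h1, h2⟩ := Finset.mem_filter.1 (hA hp)
  exact hs p (Finset.mem_filter.1 h1).2 h2

/-- Of at least 2t+1 honest members, t+1 have the same input. -/
theorem exists_combinable_input (H : Admissible t Δ GST R) {h : List (Batch n 2 2)} {v : ℕ}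
    (hs : ∀ p : Fin n, p.val < 3 * t + 1 → R.Honest p →
      Sig.share 0 p ⟨v, encode (R.input p)⟩ ∈ receivedSigs h) :
    ∃ b, Combinable t h 0 ⟨v, b⟩ := by
  have key : ∀ b, t + 1 ≤ (((committee t n).filter fun p => R.Honest p).filter
      fun p => R.input p = b).card → Combinable t h 0 ⟨v, encode b⟩ := by
    intro b hb
    obtain ⟨A, hA, hc⟩ := Finset.exists_subset_card_eq hb
    refine ⟨A, hA.trans ((Finset.filter_subset _ _).trans (Finset.filter_subset _ _)),
      by simpa [schemes] using hc, fun p hp => ?_⟩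
    obtain ⟨h0, h3⟩ := Finset.mem_filter.1 (hA hp)
    obtain ⟨h1, h2⟩ := Finset.mem_filter.1 h0
    rw [← h3]
    exact hs p (Finset.mem_filter.1 h1).2 h2
  have h1 := Finset.card_filter_add_card_filter_not
    (s := (committee t n).filter fun p => R.Honest p) (fun p => R.input p = true)
  simp only [Bool.not_eq_true] at h1
  have h2 := H.le_card_honest
  by_cases hb : t + 1 ≤ (((committee t n).filter fun p => R.Honest p).filter
      fun p => R.input p = true).card
  · exact ⟨_, key _ hb⟩
  · exact ⟨_, key false (by omega)⟩

/-- If no honest committee member knows the decision, then an honest leader finds a proposal that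
all honest members accept. -/
theorem exists_votable (H : Admissible t Δ GST R) {l : Fin n} {k : ℕ}
    (hC : Clean R GST (7 * k)) (hl : R.Honest l) (hlead : Leads t l k)
    (hlack : ∀ p : Fin n, p.val < 3 * t + 1 → R.Honest p → ¬ Knows R p (7 * k)) :
    ∃ b, ∀ p : Fin n, p.val < 3 * t + 1 → R.Honest p → ∀ s, R.view p s = 7 * k + 3 →
      ∀ b', Votable t k (R.hist p s) b' ↔ b' = b := by
  obtain ⟨s2, hG2, hent2, hv2⟩ := H.honest_enters hC hl (show 7 * k ≤ 7 * k + 2 by omega)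
  have hm := H.views.mono
  have hreq : ∀ p : Fin n, p.val < 3 * t + 1 → R.Honest p → ∃ s, R.view p s = 7 * k ∧
      ∀ σ ∈ (request t p (R.input p) (R.hist p s) (7 * k)).sigs,
        σ ∈ receivedSigs (R.hist l s2) := by
    intro p hpm hp
    obtain ⟨s, hG, hent, hv⟩ := H.honest_enters hC hp le_rfl
    refine ⟨s, hv, fun σ hσ => ?_⟩
    exact H.receive_sig hC (hp.uncorrupted s)
      (H.sends_request hent hv (hlack p hpm hp) (hlead.target_right hpm)) hv.le
      (hl.uncorrupted s2) hG2 (by omega) hσ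
  have hinput : ∀ p : Fin n, p.val < 3 * t + 1 → R.Honest p →
      Sig.share 0 p ⟨7 * k, encode (R.input p)⟩ ∈ receivedSigs (R.hist l s2) := by
    intro p hpm hp
    obtain ⟨s, -, h⟩ := hreq p hpm hp
    exact h _ (by simp [request, hpm])
  have hlocks : ∀ p : Fin n, p.val < 3 * t + 1 → R.Honest p → ∀ s', 7 * k ≤ R.view p s' →
      ∀ ρ b, Lock k (early k (R.hist p s')) ρ b → ∃ ρ' b', ρ ≤ ρ' ∧ Lock k (R.hist l s2) ρ' b' := by
    intro p hpm hp s' hs' ρ b hlk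
    obtain ⟨s, hv, h⟩ := hreq p hpm hp
    -- The voter checks its locks later than it reported them, but `early` restricts both to packets
    -- from before the superview.
    have hlk' : Lock k (early k (R.hist p s)) ρ b := by
      obtain ⟨a, -, hav, x, hx, hσ⟩ := mem_early_hist.1 hlk.1
      refine ⟨mem_early_hist.2 ⟨a, ?_, hav, x, hx, hσ⟩, hlk.2⟩
      by_contra hlt
      exact absurd (hm p (not_le.1 hlt).le) (by omega)
    obtain ⟨ρ1, b1, -, ht1, -⟩ := exists_topLock hlk'
    obtain ⟨σ, hσ⟩ := exists_mem_pick ⟨_, ht1⟩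
    obtain ⟨ρ2, b2, rfl, h2, h3⟩ := of_mem_pick hσ
    refine ⟨ρ2, b2, h3 _ _ hlk', h _ ?_, h2.2⟩
    refine List.mem_append_right _ ?_
    rwa [show 7 * k / 7 = k by omega]
  obtain ⟨σ, hσ⟩ : ∃ σ, σ ∈ pick (Emits t l (R.hist l s2) (7 * k + 2)) := by
    have : ∃ σ, Proposal t k (R.hist l s2) σ := by
      by_cases hlk : ∃ ρ b, Lock k (R.hist l s2) ρ b
      · obtain ⟨ρ, b, hlk⟩ := hlk
        obtain ⟨ρ', b', -, h, -⟩ := exists_topLock hlk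
        exact ⟨_, Or.inl h⟩
      · push Not at hlk
        obtain ⟨b, hb⟩ := H.exists_combinable_input hinput
        exact ⟨_, Or.inr ⟨hlk, b, rfl, hb⟩⟩
    obtain ⟨σ, hσ⟩ := this
    refine exists_mem_pick ⟨σ, Or.inr (Or.inl ⟨by omega, ?_⟩)⟩
    rwa [show (7 * k + 2) / 7 = k by omega]
  have hprop : Proposal t k (R.hist l s2) σ := by
    rcases of_mem_pick hσ with ⟨h, -⟩ | ⟨-, h⟩ | ⟨h, -⟩ | ⟨h, -⟩ | ⟨h, -⟩ | ⟨h, -⟩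
    all_goals first | omega | skip
    rwa [show (7 * k + 2) / 7 = k by omega] at h
  obtain ⟨b, ρ, hj, hmax⟩ : ∃ b ρ, Justifies k σ b ρ ∧
      ∀ ρ' b', Lock k (R.hist l s2) ρ' b' → ρ' ≤ ρ := by
    rcases hprop with ⟨ρ, b, rfl, h1, h2⟩ | ⟨h, b, rfl, -⟩
    · exact ⟨b, ρ, Or.inr ⟨rfl, h1.2⟩, h2⟩
    · exact ⟨b, 0, Or.inl ⟨⟨_, rfl⟩, rfl⟩, fun ρ' b' hl => absurd hl (h _ _)⟩
  refine ⟨b, fun p hpm hp s hs b' => ⟨?_, ?_⟩⟩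
  -- A packet from the honest leader stamped `7 * k + 2` stems from its unique entry at `s2`, hence
  -- carries `σ`, which determines the value.
  · rintro ⟨B, hB, ⟨p', K⟩, hx, hlead', hv, σ', hσ', ρ', hj', -⟩
    obtain rfl := hlead'.unique hlead
    obtain ⟨a, -, -, rfl⟩ := Run.mem_hist_iff.1 hB
    rcases H.exec _ _ _ _ hx with ⟨s', w, -, -, hw, rfl⟩ | ⟨h, -⟩
    · obtain ⟨hent', hw⟩ := mem_sent.1 hw
      obtain rfl := hent2.eq_of_view_eq hent' (hv2.trans hv.symm)
      dsimp only at hv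
      rw [hv] at hw
      rcases mem_act.1 hw with ⟨h, -⟩ | ⟨-, -, τ, hτ, rfl⟩
      · omega
      · obtain rfl := List.mem_singleton.1 hσ'
        obtain rfl := eq_of_mem_pick hτ hσ
        rcases hj with ⟨⟨_, rfl⟩, -⟩ | ⟨rfl, -⟩ <;> rcases hj' with ⟨⟨_, h⟩, -⟩ | ⟨h, -⟩ <;>
          cases h <;> rfl
    · exact absurd (hl.uncorrupted a) h
  · rintro rfl
    have hsent := sends_cert hent2 hv2 (by omega)
      (H.recipient_of_leads hv2 (Or.inl rfl) (hlack l hlead.1 hl) hlead hpm) hσ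
    obtain ⟨a, ha, -, hxa⟩ := H.receive (hC.mono (show 7 * k ≤ 7 * k + 2 by omega))
      (hl.uncorrupted s2) hsent hv2.le (hp.uncorrupted s) (by
        by_contra hlt
        have := hC p (hp.uncorrupted _)
        have := hm p (not_le.1 hlt).le
        omega) (by omega)
    refine ⟨_, Run.mem_hist_iff.2 ⟨a, ha, Run.active_of_mem_inbox hxa, rfl⟩, _, hxa, hlead, hv2,
      σ, by simp [certWord], ρ, hj, fun ρ' b'' hlk => ?_⟩
    obtain ⟨ρ1, b1, h1, h2⟩ := hlocks p hpm hp s (by omega) _ _ hlk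
    exact h1.trans (hmax _ _ h2)

/-- All honest members vote for the same value, so the leader obtains a vote certificate; all honest
members receive it, and their commit shares alone reach the threshold. -/
theorem exists_combinable_commit (H : Admissible t Δ GST R) {l : Fin n} {k s : ℕ}
    (hC : Clean R GST (7 * k)) (hl : R.Honest l) (hlead : Leads t l k)
    (hlack : ∀ p : Fin n, p.val < 3 * t + 1 → R.Honest p → ¬ Knows R p (7 * k))
    (hs : R.view l s = 7 * k + 6) (hG : GST ≤ s) :
    ∃ b, Combinable t (R.hist l s) 1 ⟨7 * k + 5, b⟩ := by
  obtain ⟨b, hb⟩ := H.exists_votable hC hl hlead hlack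
  obtain ⟨s4, hG4, hent4, hv4⟩ := H.honest_enters hC hl (show 7 * k ≤ 7 * k + 4 by omega)
  have hvotes : Combinable t (R.hist l s4) 1 ⟨7 * k + 3, b⟩ := by
    refine H.combinable_vote fun p hpm hp => ?_
    obtain ⟨s3, hG3, hent3, hv3⟩ := H.honest_enters hC hp (show 7 * k ≤ 7 * k + 3 by omega)
    have hb' := hb p hpm hp s3 hv3
    have hex : ∃ σ, Emits t p (R.hist p s3) (7 * k + 3) σ := by
      refine ⟨_, Or.inr (Or.inr (Or.inl ⟨by omega, b, rfl, ?_⟩))⟩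
      rw [show (7 * k + 3) / 7 = k by omega]
      exact (hb' b).2 rfl
    obtain ⟨σ, hσ⟩ := exists_mem_pick hex
    have hσe : σ = Sig.share 1 p ⟨7 * k + 3, b⟩ := by
      rcases of_mem_pick hσ with ⟨h, -⟩ | ⟨h, -⟩ | ⟨h, a, h1, h2⟩ | ⟨h, -⟩ | ⟨h, -⟩ | ⟨h, -⟩
      all_goals first | omega | skip
      rw [show (7 * k + 3) / 7 = k by omega] at h2
      rw [h1, (hb' a).1 h2]
    rw [← hσe]
    exact H.receive_sig (hC.mono (show 7 * k ≤ 7 * k + 3 by omega)) (hp.uncorrupted s3)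
      (sends_cert hent3 hv3 (by omega)
        (H.recipient_of_voter hv3 (Or.inl rfl) (hlack p hpm hp) hpm hlead) hσ)
      hv3.le (hl.uncorrupted s4) hG4 (by omega) (by simp [certWord])
  obtain ⟨σ4, hσ4⟩ : ∃ σ, σ ∈ pick (Emits t l (R.hist l s4) (7 * k + 4)) :=
    exists_mem_pick ⟨_, Or.inr (Or.inr (Or.inr (Or.inl ⟨by omega, b, rfl, hvotes⟩)))⟩
  -- The leader may have picked another combinable certificate, so the argument continues with its
  -- value `c`; that `c` equals `b` is not needed.
  obtain ⟨c, rfl⟩ : ∃ c, σ4 = Sig.full 1 ⟨7 * k + 3, c⟩ := by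
    rcases of_mem_pick hσ4 with ⟨h, -⟩ | ⟨h, -⟩ | ⟨h, -⟩ | ⟨-, c, h, -⟩ | ⟨h, -⟩ | ⟨h, -⟩
    all_goals first | omega | skip
    exact ⟨c, h⟩
  refine ⟨c, H.combinable_vote fun p hpm hp => ?_⟩
  obtain ⟨s5, hG5, hent5, hv5⟩ := H.honest_enters hC hp (show 7 * k ≤ 7 * k + 5 by omega)
  have hcert : Sig.full 1 ⟨7 * k + 3, c⟩ ∈ receivedSigs (R.hist p s5) :=
    H.receive_sig (hC.mono (show 7 * k ≤ 7 * k + 4 by omega)) (hl.uncorrupted s4)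
      (sends_cert hent4 hv4 (by omega)
        (H.recipient_of_leads hv4 (Or.inr (Or.inl rfl)) (hlack l hlead.1 hl) hlead hpm) hσ4)
      hv4.le (hp.uncorrupted s5) hG5 (by omega) (by simp [certWord])
  obtain ⟨σ, hσ⟩ : ∃ σ, σ ∈ pick (Emits t p (R.hist p s5) (7 * k + 5)) :=
    exists_mem_pick ⟨_, Or.inr (Or.inr (Or.inr (Or.inr (Or.inl ⟨by omega, c, rfl, hcert⟩))))⟩
  have hσe : σ = Sig.share 1 p ⟨7 * k + 5, c⟩ := by
    rcases of_mem_pick hσ with ⟨h, -⟩ | ⟨h, -⟩ | ⟨h, -⟩ | ⟨h, -⟩ | ⟨-, a, h1, h2⟩ | ⟨h, -⟩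
    all_goals first | omega | skip
    rw [h1, H.cert_unique (Exists.of_hist h2) (Exists.of_hist hcert)]
  rw [← hσe]
  exact H.receive_sig (hC.mono (show 7 * k ≤ 7 * k + 5 by omega)) (hp.uncorrupted s5)
    (sends_cert hent5 hv5 (by omega)
      (H.recipient_of_voter hv5 (Or.inr rfl) (hlack p hpm hp) hpm hlead) hσ)
    hv5.le (hl.uncorrupted s) hG (by omega) (by simp [certWord])

/-- A superview with an honest leader brings the decision to the whole committee. -/
theorem committee_knows (H : Admissible t Δ GST R) {l q : Fin n} {k τ : ℕ}
    (hC : Clean R GST (7 * k)) (hl : R.Honest l) (hlead : Leads t l k) (hqm : q.val < 3 * t + 1)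
    (hq : R.Uncorrupted q τ) (hτ : GST ≤ τ) (hv : 7 * k + 7 ≤ R.view q τ) :
    Knows R q (7 * k + 7) := by
  -- A leader that has the decision does not lead an attempt, but answers the members that ask.
  -- Otherwise it asks the members itself and passes on what it gets, or the attempt succeeds
  -- because no honest member abstains.
  by_cases hlk : Knows R l (7 * k)
  · exact (H.serve hC (hlead.target_right hqm) hl hlk hq hτ (by omega)).mono (by omega)
  obtain ⟨s, hG, hent, hs⟩ := H.honest_enters hC hl (show 7 * k ≤ 7 * k + 6 by omega)
  have hex : ∃ σ, Emits t l (R.hist l s) (7 * k + 6) σ := by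
    by_cases hall : ∃ p : Fin n, p.val < 3 * t + 1 ∧ R.Honest p ∧ Knows R p (7 * k)
    · obtain ⟨p, hpm, hp, hpk⟩ := hall
      obtain ⟨a, ha, x, hx, σ, hσ, hc⟩ := H.serve hC (hlead.target_left hpm) hp hpk
        (hl.uncorrupted s) hG (by omega)
      refine ⟨σ, Or.inr (Or.inr (Or.inr (Or.inr (Or.inr ⟨by omega, hc, Or.inl ?_⟩))))⟩
      refine Run.mem_receivedSigs_hist.2 ⟨a, ?_, x, hx, hσ⟩
      by_contra hlt
      exact absurd (H.views.mono l (not_le.1 hlt).le) (by omega)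
    · push Not at hall
      obtain ⟨b, hb⟩ := H.exists_combinable_commit hC hl hlead hall hs hG
      exact ⟨_, Or.inr (Or.inr (Or.inr (Or.inr (Or.inr
        ⟨by omega, ⟨k, b, rfl⟩, Or.inr ⟨b, rfl, hb⟩⟩))))⟩
  obtain ⟨σ, hσ⟩ := exists_mem_pick hex
  obtain ⟨a, -, ha, hx⟩ := H.receive (hC.mono (show 7 * k ≤ 7 * k + 6 by omega))
    (hl.uncorrupted s) (sends_cert hent hs (by omega)
      (H.recipient_of_leads hs (Or.inr (Or.inr rfl)) hlk hlead hqm) hσ) hs.le hq hτ (by omega)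
  refine ⟨a, by omega, _, hx, σ, by simp [certWord], ?_⟩
  rcases of_mem_pick hσ with ⟨h, -⟩ | ⟨h, -⟩ | ⟨h, -⟩ | ⟨h, -⟩ | ⟨h, -⟩ | ⟨-, h, -⟩
  all_goals omega

end Admissible

/-! ### Spreading the decision, and termination. -/

/-- After `GST`, party `q` reaches superview `k` uncorrupted and without knowing the decision. -/
def Lacks (R : Run n 2 2) (GST : ℕ) (q : Fin n) (k : ℕ) : Prop :=
  ∃ τ, GST ≤ τ ∧ R.Uncorrupted q τ ∧ 7 * k ≤ R.view q τ ∧ ¬ Knows R q (7 * k)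

/-- Superview `k` runs after `GST` and has an honest leader. -/
def Good (t : ℕ) (R : Run n 2 2) (GST k : ℕ) : Prop :=
  Clean R GST (7 * k) ∧ ∃ l, R.Honest l ∧ Leads t l k

theorem not_lacks_of_knows {q : Fin n} {k k' : ℕ} (hk : k < k')
    (h : ∀ τ, GST ≤ τ → R.Uncorrupted q τ → 7 * k + 7 ≤ R.view q τ → Knows R q (7 * k + 7)) :
    ¬ Lacks R GST q k' := by
  rintro ⟨τ, hτ, hq, hv, hl⟩
  exact hl ((h τ hτ hq (by omega)).mono (by omega))

theorem Target.of_member {p q : Fin n} {k : ℕ} (hT : Target t p q k) (hp : p.val < 3 * t + 1) :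
    q.val < 3 * t + 1 ∧ k % (3 * t + 3) < 3 * t + 1 ∧
      (p.val = k % (3 * t + 3) ∨ q.val = k % (3 * t + 3)) := by
  rcases hT with ⟨-, h⟩ | ⟨h, -⟩ | ⟨h, -⟩
  · exact h
  all_goals omega

theorem Target.div_eq_or_lt {p q : Fin n} {k : ℕ} (hT : Target t p q k) :
    q.val < 3 * t + 1 ∨ q.val / (3 * t + 1) = p.val / (3 * t + 1) := by
  rcases hT with ⟨-, h, -⟩ | ⟨-, h, -⟩ | ⟨-, -, h⟩
  · exact Or.inl h
  · exact Or.inl h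
  · right
    rw [h, mul_comm, Nat.mul_add_div (by omega), Nat.div_eq_of_lt (Nat.mod_lt _ (by omega)),
      add_zero]

namespace Admissible

theorem exists_view_ge (H : Admissible t Δ GST R) {p : Fin n} (hp : R.Honest p) (v : ℕ) :
    ∃ τ, GST ≤ τ ∧ v ≤ R.view p τ := by
  obtain ⟨τ, hτ⟩ := H.views.unbounded p hp v
  exact ⟨max GST τ, le_max_left _ _, hτ.trans (H.views.mono p (le_max_right _ _))⟩

theorem not_lacks_member (H : Admissible t Δ GST R) {k0 k : ℕ} (h0 : Good t R GST k0)
    (hk : k0 < k) {q : Fin n} (hq : q.val < 3 * t + 1) : ¬ Lacks R GST q k := by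
  obtain ⟨hC, l, hl, hlead⟩ := h0
  exact not_lacks_of_knows hk fun τ hτ hu hv => H.committee_knows hC hl hlead hq hu hτ hv

theorem knows_of_not_lacks (H : Admissible t Δ GST R) {q : Fin n} {k : ℕ} (hq : R.Honest q)
    (h : ¬ Lacks R GST q k) : Knows R q (7 * k) := by
  obtain ⟨τ, hτ, hv⟩ := H.exists_view_ge hq (7 * k)
  by_contra hc
  exact h ⟨τ, hτ, hq.uncorrupted τ, hv, hc⟩

theorem not_lacks_of_target (H : Admissible t Δ GST R) {k k' : ℕ} (hC : Clean R GST (7 * k))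
    (hk : k < k') {p q : Fin n} (hT : Target t q p k) (hp : R.Honest p)
    (hl : ¬ Lacks R GST p k) : ¬ Lacks R GST q k' :=
  not_lacks_of_knows hk fun _ hτ hu hv =>
    (H.serve hC hT hp (H.knows_of_not_lacks hp hl) hu hτ (by omega)).mono (by omega)

theorem exists_honest_member (H : Admissible t Δ GST R) :
    ∃ p : Fin n, p.val < 3 * t + 1 ∧ R.Honest p := by
  obtain ⟨p, hp, hh⟩ := H.exists_honest (A := committee t n) (by rw [H.card_committee]; omega)
  exact ⟨p, (Finset.mem_filter.1 hp).2, hh⟩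

/-- After the good superview the committee is informed, and it contains an honest member that
answers. -/
theorem not_lacks_asker (H : Admissible t Δ GST R) {k0 k k' : ℕ} (h0 : Good t R GST k0)
    (hk : k0 < k) (hk' : k < k') {q : Fin n} (hslot : k % (3 * t + 3) = 3 * t + 1)
    (hq : 3 * t + 1 ≤ q.val) (hqk : q.val % (3 * t + 1) = k / (3 * t + 3) % (3 * t + 1)) :
    ¬ Lacks R GST q k' := by
  obtain ⟨p, hpm, hp⟩ := H.exists_honest_member
  exact H.not_lacks_of_target (h0.1.mono (by omega)) hk' (Or.inr (Or.inl ⟨hq, hpm, hslot, hqk⟩)) hp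
    (H.not_lacks_member h0 hk hpm)

/-- The honest representative `l` had its turn to ask the committee one superview earlier, so it can
answer now. That superview is still after `k0`, because `k0` is an attempt and not a service
superview. -/
theorem not_lacks_group (H : Admissible t Δ GST R) {k0 k k' : ℕ} (h0 : Good t R GST k0)
    (hk : k0 < k) (hk' : k < k') {l q : Fin n} (hslot : k % (3 * t + 3) = 3 * t + 2)
    (hT : Target t q l k) (hl : R.Honest l) : ¬ Lacks R GST q k' := by
  obtain ⟨-, l0, -, hl0⟩ := id h0
  have hlt := hl0.lt
  rcases hT with ⟨-, -, h, -⟩ | ⟨-, -, h, -⟩ | ⟨hq, -, hql⟩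
  · omega
  · omega
  obtain ⟨k, rfl⟩ : ∃ j, k = j + 1 := ⟨k - 1, by omega⟩
  have hmod : k % (3 * t + 3) = 3 * t + 1 ∧ (k + 1) / (3 * t + 3) = k / (3 * t + 3) := by
    have h1 := Nat.div_add_mod (k + 1) (3 * t + 3)
    generalize (k + 1) / (3 * t + 3) = e at *
    have h2 : k = (3 * t + 3) * e + (3 * t + 1) := by omega
    rw [h2, Nat.mul_add_mod, Nat.mul_add_div (by omega), Nat.mod_eq_of_lt (by omega),
      Nat.div_eq_of_lt (by omega)]
    exact ⟨rfl, rfl⟩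
  have hkk : k0 < k := by
    rcases Nat.lt_or_eq_of_le (Nat.lt_succ_iff.1 hk) with h | rfl
    · exact h
    · omega
  refine H.not_lacks_of_target (h0.1.mono (by omega)) hk' (Or.inr (Or.inr ⟨hq, hslot, hql⟩)) hl
    (H.not_lacks_asker h0 hkk (Nat.lt_succ_self k) hmod.1 ?_ ?_)
  · have := Nat.mul_le_mul_right (3 * t + 1) ((Nat.one_le_div_iff (by omega)).2 hq)
    omega
  · rw [hql, hmod.2, mul_comm, Nat.mul_add_mod, Nat.mod_mod]

theorem decided_of_knows (H : Admissible t Δ GST R) {p : Fin n} {v : ℕ} (h : Knows R p v) :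
    ∃ τ b, R.Decided (protocol t n) p τ b := by
  obtain ⟨s, -, x, hx, σ, hσ, j, b, rfl⟩ := h
  obtain ⟨a, rfl⟩ : ∃ a, encode a = b := by
    fin_cases b
    · exact ⟨false, rfl⟩
    · exact ⟨true, rfl⟩
  exact ⟨s, a, H.decided_iff.2 ⟨j, Run.mem_receivedSigs_hist.2 ⟨s, le_rfl, x, hx, hσ⟩⟩⟩

theorem termination (H : Admissible t Δ GST R) {k0 : ℕ} (h0 : Good t R GST k0) :
    R.Termination (protocol t n) := by
  intro q hq
  by_cases hqm : q.val < 3 * t + 1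
  · exact H.decided_of_knows (H.knows_of_not_lacks hq
      (H.not_lacks_member h0 (Nat.lt_succ_self k0) hqm))
  · have hr := Nat.mod_lt q.val (show 0 < 3 * t + 1 by omega)
    -- An epoch number that is at least `k0` and congruent to `q` modulo `3 * t + 1`, so that `q`
    -- represents its group in it.
    set e := (3 * t + 1) * k0 + q.val % (3 * t + 1) with he
    have hk0 : k0 ≤ e := (Nat.le_mul_of_pos_left k0 (by omega)).trans (Nat.le_add_right _ _)
    have hk : k0 < (3 * t + 3) * e + (3 * t + 1) := by
      have := Nat.le_mul_of_pos_left e (show 0 < 3 * t + 3 by omega)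
      omega
    refine H.decided_of_knows (H.knows_of_not_lacks hq
      (H.not_lacks_asker h0 hk (Nat.lt_succ_self _) ?_ (by omega) ?_))
    · rw [Nat.mul_add_mod, Nat.mod_eq_of_lt (by omega)]
    · rw [Nat.mul_add_div (by omega), Nat.div_eq_of_lt (by omega), add_zero, he, Nat.mul_add_mod,
        Nat.mod_mod]

/-- Pigeonhole: f+3 consecutive superviews have distinct slots within the epoch, as f ≤ t. Two slots
are for service and at most f have a faulty leader. -/
theorem exists_good_ge (H : Admissible t Δ GST R) {k : ℕ} (hC : Clean R GST (7 * k)) :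
    ∃ k0, k0 ≤ k + R.numFaulty + 2 ∧ Good t R GST k0 := by
  by_contra! hc
  have hf := H.numFaulty_le
  have hn := H.resilience
  have hinj : Set.InjOn (fun j => j % (3 * t + 3)) (Finset.Icc k (k + R.numFaulty + 2)) := by
    intro a ha b hb hab
    simp only [Finset.coe_Icc, Set.mem_Icc] at ha hb
    have hab : a ≡ b [MOD (3 * t + 3)] := hab
    rcases le_total a b with h | h
    · exact hab.eq_of_abs_lt (by rw [abs_lt]; constructor <;> push_cast <;> omega)
    · exact hab.eq_of_abs_lt (by rw [abs_lt]; constructor <;> push_cast <;> omega)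
  have hmaps : ∀ j ∈ Finset.Icc k (k + R.numFaulty + 2), j % (3 * t + 3) ∈
      ((Finset.univ.filter fun p => ¬ R.Honest p).image Fin.val) ∪ {3 * t + 1, 3 * t + 2} := by
    intro j hj
    obtain ⟨hj1, hj2⟩ := Finset.mem_Icc.1 hj
    have hlt := Nat.mod_lt j (show 0 < 3 * t + 3 by omega)
    rw [Finset.mem_union, Finset.mem_image]
    by_cases hs : j % (3 * t + 3) < 3 * t + 1
    · refine Or.inl ⟨⟨j % (3 * t + 3), by omega⟩, Finset.mem_filter.2 ⟨Finset.mem_univ _, ?_⟩, rfl⟩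
      exact fun hl => hc j hj2 ⟨hC.mono (by omega), _, hl, hs, rfl⟩
    · right
      rw [Finset.mem_insert, Finset.mem_singleton]
      omega
  have h1 := Finset.card_le_card_of_injOn _ hmaps hinj
  have h2 := (Finset.card_union_le ((Finset.univ.filter fun p => ¬ R.Honest p).image Fin.val)
    {3 * t + 1, 3 * t + 2})
  have h3 : ((Finset.univ.filter fun p => ¬ R.Honest p).image Fin.val).card ≤ R.numFaulty :=
    Finset.card_image_le
  have h4 : ({3 * t + 1, 3 * t + 2} : Finset ℕ).card ≤ 2 := Finset.card_le_two
  rw [Nat.card_Icc] at h1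
  omega

/-- There is a good superview soon after `GST`. -/
theorem exists_good (H : Admissible t Δ GST R) :
    ∃ a k0, k0 ≤ a + R.numFaulty + 4 ∧ Good t R GST k0 ∧
      ∀ q τ, GST ≤ τ → R.Uncorrupted q τ → 7 * a ≤ R.view q τ := by
  obtain ⟨p, -, hp⟩ := H.exists_honest_member
  have hpu := hp.uncorrupted GST
  have hC : Clean R GST (7 * ((R.view p GST + 1) / 7 + 1)) := by
    intro q hq
    have := H.views.close p q GST le_rfl hpu hq
    omega
  obtain ⟨k0, hle, hk0⟩ := H.exists_good_ge hC
  -- At `GST` the views of uncorrupted parties differ from that of `p` by at most one, so none is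
  -- below superview `a`; rounding costs the additional 2 in the bound.
  refine ⟨(R.view p GST - 1) / 7, k0, by omega, hk0, fun q τ hτ hq => ?_⟩
  have := H.views.close q p GST le_rfl (hq.mono hτ) hpu
  have := H.views.mono q hτ
  omega

end Admissible

/-! ### Charging words to demand, supply and waste. -/

/-- The number of parties that `q` may ask in superview `k`. -/
noncomputable def numTargets (t : ℕ) (q : Fin n) (k : ℕ) : ℕ :=
  (Finset.univ.filter fun p => Target t q p k).card

/-- The number of parties that `q` has reason to ask in superview `k`. -/
noncomputable def demand (t : ℕ) (R : Run n 2 2) (GST : ℕ) (q : Fin n) (k : ℕ) : ℕ :=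
  if Lacks R GST q k then numTargets t q k else 0

/-- The number of parties that have reason to ask `p` in superview `k`. -/
noncomputable def supply (t : ℕ) (R : Run n 2 2) (GST : ℕ) (p : Fin n) (k : ℕ) : ℕ :=
  (Finset.univ.filter fun q => Lacks R GST q k ∧ Target t q p k).card

/-- The number of corrupted parties to which `p` gives the decision at tick `τ`. -/
noncomputable def wasted (t : ℕ) (R : Run n 2 2) (p : Fin n) (τ : ℕ) : ℕ :=
  (Finset.univ.filter fun q => ¬ R.Honest q ∧ Answers t p q (R.hist p τ)).card

/-- Double counting of pairs of a party in need and a party that it may ask. -/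
theorem sum_supply (k : ℕ) :
    ∑ p, supply t R GST p k = ∑ q, demand t R GST q k := by
  simp only [supply, demand, numTargets, Finset.card_filter]
  rw [Finset.sum_comm]
  refine Finset.sum_congr rfl fun q _ => ?_
  split_ifs with h <;> simp [h]

theorem length_filter_finRange (P : Fin n → Prop) :
    ((List.finRange n).filter fun q => P q).length = (Finset.univ.filter P).card := by
  rw [← List.toFinset_card_of_nodup ((List.nodup_finRange n).filter _)]
  congr 1
  ext q
  simp

theorem length_act_le (p : Fin n) (b : Bool) (h : List (Batch n 2 2)) (v : ℕ) :
    (act t p b h v).length ≤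
      if v % 7 = 0 then (if HasDecision (v / 7) h then 0 else numTargets t p (v / 7))
      else (Finset.univ.filter fun q => Recipient t p h v q).card := by
  unfold act
  split_ifs
  · simp
  · rw [List.length_map, length_filter_finRange, numTargets]
  · have hl := length_pick_le (Emits t p h v)
    generalize pick (Emits t p h v) = l at hl ⊢
    rcases l with _ | ⟨σ, _ | ⟨σ', l⟩⟩
    · simp
    · rw [List.flatMap_singleton, List.length_map, length_filter_finRange]
    · simp at hl

namespace Admissible

/-- In an attempt, words flow only between the leader and members, along pairs that are also targets
of requests. Senders lack the decision, so the demand of the sender pays. -/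
theorem card_recipient_le (H : Admissible t Δ GST R) {p : Fin n} {τ : ℕ} (hτ : GST ≤ τ)
    (hp : R.Uncorrupted p τ) (hr : R.view p τ % 7 ≠ 1) :
    (Finset.univ.filter fun q => Recipient t p (R.hist p τ) (R.view p τ) q).card ≤
      demand t R GST p (R.view p τ / 7) := by
  unfold demand
  split_ifs with hl
  · refine Finset.card_le_card (Finset.monotone_filter_right _ fun q _ hq => ?_)
    rcases hq with ⟨h, -⟩ | ⟨-, -, ⟨h, hq, -⟩ | ⟨h, hq, -⟩⟩
    · exact absurd h hr
    · exact h.target_left hq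
    · exact hq.target_right h
  · rw [Nat.le_zero, Finset.card_eq_zero, Finset.filter_eq_empty_iff]
    rintro q - (⟨h, -⟩ | ⟨-, h, -⟩)
    · exact hr h
    · have hle := Nat.mul_div_le (R.view p τ) 7
      rw [hasDecision_hist (H.views.mono p) hle] at h
      exact hl ⟨τ, hτ, hp, hle, h⟩

/-- A request from an honest party is genuine, so that party did lack the decision and is counted in
the supply of `p`. -/
theorem card_answers_le (H : Admissible t Δ GST R) {p : Fin n} {τ : ℕ}
    (he : R.Enters p τ) :
    (Finset.univ.filter fun q => Answers t p q (R.hist p τ)).card ≤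
      supply t R GST p (R.view p τ / 7) + wasted t R p τ := by
  refine (Finset.card_le_card fun q hq => ?_).trans (Finset.card_union_le _ _)
  have hans := (Finset.mem_filter.1 hq).2
  rw [Finset.mem_union, Finset.mem_filter, Finset.mem_filter]
  by_cases hqh : R.Honest q
  swap
  · exact Or.inr ⟨Finset.mem_univ _, hqh, hans⟩
  left
  obtain ⟨⟨k, hfresh, -, hT, B, hB, ⟨q', K⟩, hx, rfl, hKv⟩, -⟩ := hans
  have hv := ((fresh_hist he.active).1 hfresh).1
  have hk : R.view p τ / 7 = k := by omega
  rw [hk]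
  refine ⟨Finset.mem_univ _, ?_, hT⟩
  obtain ⟨s', -, -, rfl⟩ := Run.mem_hist_iff.1 hB
  rcases H.exec _ _ _ _ hx with ⟨s, w, -, -, hw, rfl⟩ | ⟨h, -⟩
  · obtain ⟨-, hw⟩ := mem_sent.1 hw
    dsimp only at hKv
    rw [hKv] at hw
    rcases mem_act.1 hw with ⟨-, h, -⟩ | ⟨h, -⟩
    · rw [show 7 * k / 7 = k by omega, hasDecision_hist (H.views.mono q') hKv.ge] at h
      have := H.views.mono q' (le_max_right GST s)
      -- The request may predate `GST`; the witness tick is moved to `GST`, which does not change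
      -- what was known before view `7 * k`.
      exact ⟨max GST s, le_max_left _ _, hqh.uncorrupted _, hKv.ge.trans this, h⟩
    · omega
  · exact absurd (hqh.uncorrupted _) h

theorem length_sent_le (H : Admissible t Δ GST R) {p : Fin n} {τ : ℕ} (hτ : GST ≤ τ)
    (hp : R.Uncorrupted p τ) (he : R.Enters p τ) :
    (R.sent (protocol t n) p τ).length ≤ demand t R GST p (R.view p τ / 7) +
      supply t R GST p (R.view p τ / 7) + wasted t R p τ := by
  rw [sent_eq, if_pos he]
  refine (length_act_le p _ _ _).trans ?_
  have hle := Nat.mul_div_le (R.view p τ) 7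
  split_ifs with h0 hd
  · exact Nat.zero_le _
  · rw [hasDecision_hist (H.views.mono p) hle] at hd
    have : demand t R GST p (R.view p τ / 7) = numTargets t p (R.view p τ / 7) :=
      if_pos ⟨τ, hτ, hp, hle, hd⟩
    omega
  · by_cases h1 : R.view p τ % 7 = 1
    · have hsub : (Finset.univ.filter fun q => Recipient t p (R.hist p τ) (R.view p τ) q).card ≤
          (Finset.univ.filter fun q => Answers t p q (R.hist p τ)).card := by
        refine Finset.card_le_card (Finset.monotone_filter_right _ fun q _ hq => ?_)
        rcases hq with ⟨-, h⟩ | ⟨h, -⟩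
        · exact h
        · exact absurd h1 h
      have := H.card_answers_le he
      omega
    · have := H.card_recipient_le hτ hp h1
      omega

end Admissible

/-- The ticks from `a` until `b` at which `p` enters a view uncorrupted. -/
noncomputable def entries (R : Run n 2 2) (p : Fin n) (a b : ℕ) : Finset ℕ :=
  (Finset.Ico a b).filter fun τ => R.Uncorrupted p τ ∧ R.Enters p τ

theorem card_entries_superview_le (p : Fin n) (a b k : ℕ) :
    ((entries R p a b).filter fun τ => R.view p τ / 7 = k).card ≤ 7 := by
  have : (Finset.Ico (7 * k) (7 * k + 7)).card = 7 := by rw [Nat.card_Ico]; omega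
  refine le_of_le_of_eq ?_ this
  refine Finset.card_le_card_of_injOn (R.view p) (fun τ hτ => ?_) (fun τ hτ τ' hτ' h => ?_)
  · have : R.view p τ / 7 = k := (Finset.mem_filter.1 hτ).2
    rw [Finset.mem_coe, Finset.mem_Ico]
    omega
  · have h1 := (Finset.mem_filter.1 (Finset.mem_filter.1 hτ).1).2.2
    have h2 := (Finset.mem_filter.1 (Finset.mem_filter.1 hτ').1).2.2
    exact h1.eq_of_view_eq h2 h

theorem sum_entries_le (p : Fin n) {a b A B : ℕ} (g : ℕ → ℕ)
    (hAB : ∀ τ ∈ entries R p a b, R.view p τ / 7 ∈ Finset.Ico A B) :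
    ∑ τ ∈ entries R p a b, g (R.view p τ / 7) ≤ ∑ k ∈ Finset.Ico A B, 7 * g k := by
  rw [← Finset.sum_fiberwise_of_maps_to hAB]
  refine Finset.sum_le_sum fun k _ => ?_
  rw [Finset.sum_congr rfl fun τ hτ => by rw [(Finset.mem_filter.1 hτ).2], Finset.sum_const,
    smul_eq_mul]
  exact Nat.mul_le_mul_right _ (card_entries_superview_le p a b k)

theorem card_group_le (t : ℕ) (j : ℕ) :
    (Finset.univ.filter fun p : Fin n => p.val / (3 * t + 1) = j).card ≤ 3 * t + 1 := by
  conv_rhs => rw [← Finset.card_range (3 * t + 1)]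
  refine Finset.card_le_card_of_injOn (fun p => p.val % (3 * t + 1)) (fun p _ => ?_)
    (fun p hp q hq h => ?_)
  · exact Finset.mem_coe.2 (Finset.mem_range.2 (Nat.mod_lt _ (by omega)))
  · have hp := (Finset.mem_filter.1 hp).2
    have hq := (Finset.mem_filter.1 hq).2
    dsimp only at h
    rw [Fin.ext_iff, ← Nat.div_add_mod p.val (3 * t + 1), ← Nat.div_add_mod q.val (3 * t + 1),
      hp, hq, h]

theorem Answers.target {p q : Fin n} {h : List (Batch n 2 2)} (ha : Answers t p q h) :
    ∃ k, Target t q p k := by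
  obtain ⟨⟨k, -, -, hT, -⟩, -⟩ := ha
  exact ⟨k, hT⟩

/-- Of two answers to `q`, the later would be given by a party whose earlier history already shows
the request. -/
theorem card_filter_answers_le (p q : Fin n) (a b : ℕ) :
    ((entries R p a b).filter fun τ => Answers t p q (R.hist p τ)).card ≤
      if ∃ k, Target t q p k then 1 else 0 := by
  split_ifs with h
  · rw [Finset.card_le_one]
    have key : ∀ τ τ', R.Enters p τ' → Answers t p q (R.hist p τ) → Answers t p q (R.hist p τ') →
        ¬ τ < τ' := fun τ τ' he hτ hτ' hlt =>
      hτ'.2 _ (Run.hist_suffix hlt.le) (Run.hist_ne_of_lt hlt he.active) hτ.1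
    intro τ hτ τ' hτ'
    obtain ⟨hτ, ha⟩ := Finset.mem_filter.1 hτ
    obtain ⟨hτ', ha'⟩ := Finset.mem_filter.1 hτ'
    have h1 := key τ τ' (Finset.mem_filter.1 hτ').2.2 ha ha'
    have h2 := key τ' τ (Finset.mem_filter.1 hτ).2.2 ha' ha
    omega
  · rw [Nat.le_zero, Finset.card_eq_zero, Finset.filter_eq_empty_iff]
    exact fun τ _ ha => h ha.target

namespace Admissible

theorem card_askable_le (H : Admissible t Δ GST R) (q : Fin n) :
    (Finset.univ.filter fun p => ∃ k, Target t q p k).card ≤ 2 * (3 * t + 1) := by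
  have h1 := H.card_committee
  have h2 := card_group_le (n := n) t (q.val / (3 * t + 1))
  have h3 := Finset.card_union_le (committee t n)
    (Finset.univ.filter fun p : Fin n => p.val / (3 * t + 1) = q.val / (3 * t + 1))
  refine (Finset.card_le_card fun p hp => ?_).trans (h3.trans (by omega))
  obtain ⟨k, hT⟩ := (Finset.mem_filter.1 hp).2
  rw [Finset.mem_union, committee, Finset.mem_filter, Finset.mem_filter]
  rcases hT.div_eq_or_lt with h | h
  · exact Or.inl ⟨Finset.mem_univ _, h⟩
  · exact Or.inr ⟨Finset.mem_univ _, h⟩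

theorem sum_wasted_le (H : Admissible t Δ GST R) (a b : ℕ) :
    ∑ p, ∑ τ ∈ entries R p a b, wasted t R p τ ≤ 2 * (3 * t + 1) * R.numFaulty := by
  have h1 : ∀ p, ∑ τ ∈ entries R p a b, wasted t R p τ ≤
      ∑ q ∈ Finset.univ.filter (fun q => ¬ R.Honest q),
        if ∃ k, Target t q p k then 1 else 0 := by
    intro p
    have : ∀ τ, wasted t R p τ = ∑ q ∈ Finset.univ.filter (fun q => ¬ R.Honest q),
        if Answers t p q (R.hist p τ) then 1 else 0 := by
      intro τ
      rw [wasted, ← Finset.filter_filter, Finset.card_filter]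
    simp only [this]
    rw [Finset.sum_comm]
    refine Finset.sum_le_sum fun q _ => ?_
    rw [← Finset.card_filter]
    exact card_filter_answers_le p q a b
  refine (Finset.sum_le_sum fun p _ => h1 p).trans ?_
  rw [Finset.sum_comm, Run.numFaulty, mul_comm]
  refine Finset.sum_le_card_nsmul _ _ _ fun q _ => ?_
  rw [← Finset.card_filter]
  exact H.card_askable_le q

/-- All words are requests for the decision, attempts to reach it by parties that have reason to
ask for it, or answers. -/
theorem wordsSent_le (H : Admissible t Δ GST R) {a : ℕ} (T : ℕ)
    (ha : ∀ q τ, GST ≤ τ → R.Uncorrupted q τ → 7 * a ≤ R.view q τ) :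
    ∃ b, R.wordsSent (protocol t n) GST T ≤
      14 * ∑ k ∈ Finset.Ico a b, ∑ q, demand t R GST q k +
        2 * (3 * t + 1) * R.numFaulty := by
  refine ⟨∑ p, R.view p T + 1, ?_⟩
  set b := ∑ p, R.view p T + 1 with hb
  have hmem : ∀ p, ∀ τ ∈ entries R p GST T, R.view p τ / 7 ∈ Finset.Ico a b := by
    intro p τ hτ
    obtain ⟨hτ, hu, -⟩ := Finset.mem_filter.1 hτ
    obtain ⟨h1, h2⟩ := Finset.mem_Ico.1 hτ
    have h3 := ha p τ h1 hu
    have h4 := H.views.mono p h2.le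
    have h5 : R.view p T ≤ ∑ p, R.view p T :=
      Finset.single_le_sum (f := fun p => R.view p T) (fun _ _ => Nat.zero_le _)
        (Finset.mem_univ p)
    rw [Finset.mem_Ico]
    omega
  have hparty : ∀ p, ∑ τ ∈ Finset.Ico GST T,
      (if R.Uncorrupted p τ then (R.sent (protocol t n) p τ).length else 0) ≤
        ∑ k ∈ Finset.Ico a b, 7 * (demand t R GST p k + supply t R GST p k) +
          ∑ τ ∈ entries R p GST T, wasted t R p τ := by
    intro p
    have h1 : ∑ τ ∈ Finset.Ico GST T,
        (if R.Uncorrupted p τ then (R.sent (protocol t n) p τ).length else 0) =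
          ∑ τ ∈ entries R p GST T, (R.sent (protocol t n) p τ).length := by
      rw [entries, Finset.sum_filter]
      refine Finset.sum_congr rfl fun τ _ => ?_
      by_cases hu : R.Uncorrupted p τ <;> by_cases he : R.Enters p τ <;> simp [hu, he, sent_eq]
    rw [h1]
    calc ∑ τ ∈ entries R p GST T, (R.sent (protocol t n) p τ).length
        ≤ ∑ τ ∈ entries R p GST T, ((fun k => demand t R GST p k + supply t R GST p k)
            (R.view p τ / 7) + wasted t R p τ) := by
          refine Finset.sum_le_sum fun τ hτ => ?_
          obtain ⟨hτ, hu, he⟩ := Finset.mem_filter.1 hτ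
          exact H.length_sent_le (Finset.mem_Ico.1 hτ).1 hu he
      _ ≤ _ := by
          rw [Finset.sum_add_distrib]
          exact Nat.add_le_add_right (sum_entries_le p
            (fun k => demand t R GST p k + supply t R GST p k) (hmem p)) _
  calc R.wordsSent (protocol t n) GST T
      = ∑ p, ∑ τ ∈ Finset.Ico GST T,
          (if R.Uncorrupted p τ then (R.sent (protocol t n) p τ).length else 0) := by
        rw [Run.wordsSent, Finset.sum_comm]
    _ ≤ ∑ p, (∑ k ∈ Finset.Ico a b, 7 * (demand t R GST p k + supply t R GST p k) +
          ∑ τ ∈ entries R p GST T, wasted t R p τ) := Finset.sum_le_sum fun p _ => hparty p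
    _ = 14 * ∑ k ∈ Finset.Ico a b, ∑ q, demand t R GST q k +
          ∑ p, ∑ τ ∈ entries R p GST T, wasted t R p τ := by
        rw [Finset.sum_add_distrib, Finset.sum_comm, Finset.mul_sum]
        congr 1
        refine Finset.sum_congr rfl fun k _ => ?_
        rw [← Finset.mul_sum, Finset.sum_add_distrib, sum_supply]
        ring
    _ ≤ _ := Nat.add_le_add_left (H.sum_wasted_le GST T) _

end Admissible

/-! ### Bounding the demand before and after the good superview. -/

/-- Party `q` asks the committee on behalf of its group in superview `k`. -/
def AsksCommittee (t : ℕ) (R : Run n 2 2) (GST : ℕ) (q : Fin n) (k : ℕ) : Prop :=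
  k % (3 * t + 3) = 3 * t + 1 ∧ 3 * t + 1 ≤ q.val ∧
    q.val % (3 * t + 1) = k / (3 * t + 3) % (3 * t + 1) ∧ Lacks R GST q k

/-- Party `q` asks a member of its group in superview `k`. -/
def AsksGroup (t : ℕ) (R : Run n 2 2) (GST : ℕ) (q : Fin n) (k : ℕ) : Prop :=
  k % (3 * t + 3) = 3 * t + 2 ∧ (∃ l, Target t q l k) ∧ Lacks R GST q k

/-- One element per block of length `m`: block `0` is excluded, which makes up for a possibly
incomplete last block. -/
theorem mul_card_le_of_injOn_div {Q : Finset (Fin n)} {m : ℕ} (hm : 0 < m)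
    (hQ : ∀ q ∈ Q, m ≤ q.val) (hinj : Set.InjOn (fun q : Fin n => q.val / m) Q) :
    m * Q.card ≤ n := by
  have h : Q.card ≤ (Finset.Icc 1 ((n - 1) / m)).card := by
    refine Finset.card_le_card_of_injOn _ (fun q hq => ?_) hinj
    rw [Finset.mem_coe, Finset.mem_Icc]
    exact ⟨(Nat.one_le_div_iff hm).2 (hQ q hq), Nat.div_le_div_right (by omega)⟩
  rw [Nat.card_Icc, Nat.add_sub_cancel] at h
  exact (Nat.mul_le_mul_left m h).trans ((Nat.mul_div_le _ _).trans (Nat.sub_le _ _))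

theorem numTargets_le_attempt (hn : 3 * t < n) (q : Fin n) {k : ℕ}
    (hk : k % (3 * t + 3) < 3 * t + 1) :
    numTargets t q k ≤ (if q.val < 3 * t + 1 then 1 else 0) +
      if q.val = k % (3 * t + 3) then 3 * t + 1 else 0 := by
  by_cases hq : q.val < 3 * t + 1
  · rw [if_pos hq]
    by_cases hs : q.val = k % (3 * t + 3)
    · rw [if_pos hs]
      refine le_trans (Finset.card_le_card (t := committee t n) fun p hp => ?_) ?_
      · exact Finset.mem_filter.2 ⟨Finset.mem_univ _,
          ((Finset.mem_filter.1 hp).2.of_member hq).1⟩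
      · rw [committee, Fin.card_filter_val_lt]
        omega
    · rw [if_neg hs, add_zero, numTargets, Finset.card_le_one]
      intro p hp p' hp'
      have h := ((Finset.mem_filter.1 hp).2.of_member hq).2.2
      have h' := ((Finset.mem_filter.1 hp').2.of_member hq).2.2
      exact Fin.ext (by omega)
  · refine le_trans (le_of_eq ?_) (Nat.zero_le _)
    rw [numTargets, Finset.card_eq_zero, Finset.filter_eq_empty_iff]
    rintro p - (⟨h, -⟩ | ⟨-, -, h, -⟩ | ⟨-, h, -⟩) <;> omega

theorem numTargets_le_committee (hn : 3 * t < n) (q : Fin n) {k : ℕ}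
    (hk : k % (3 * t + 3) = 3 * t + 1) :
    numTargets t q k ≤
      if 3 * t + 1 ≤ q.val ∧ q.val % (3 * t + 1) = k / (3 * t + 3) % (3 * t + 1)
      then 3 * t + 1 else 0 := by
  split_ifs with h
  · refine le_trans (Finset.card_le_card (t := committee t n) fun p hp => ?_) ?_
    · refine Finset.mem_filter.2 ⟨Finset.mem_univ _, ?_⟩
      rcases (Finset.mem_filter.1 hp).2 with ⟨-, h, -⟩ | ⟨-, h, -⟩ | ⟨-, h, -⟩
      · exact h
      · exact h
      · omega
    · rw [committee, Fin.card_filter_val_lt]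
      omega
  · rw [Nat.le_zero, numTargets, Finset.card_eq_zero, Finset.filter_eq_empty_iff]
    rintro p - (⟨-, -, h', -⟩ | ⟨h1, -, -, h2⟩ | ⟨-, h', -⟩)
    · omega
    · exact h ⟨h1, h2⟩
    · omega

theorem numTargets_le_group (q : Fin n) {k : ℕ} (hk : k % (3 * t + 3) = 3 * t + 2) :
    numTargets t q k ≤ if ∃ l, Target t q l k then 1 else 0 := by
  split_ifs with h
  · rw [numTargets, Finset.card_le_one]
    intro p hp p' hp'
    rcases (Finset.mem_filter.1 hp).2 with ⟨-, -, h, -⟩ | ⟨-, -, h, -⟩ | ⟨-, -, h⟩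
    · omega
    · omega
    rcases (Finset.mem_filter.1 hp').2 with ⟨-, -, h', -⟩ | ⟨-, -, h', -⟩ | ⟨-, -, h'⟩
    · omega
    · omega
    exact Fin.ext (h.trans h'.symm)
  · rw [Nat.le_zero, numTargets, Finset.card_eq_zero, Finset.filter_eq_empty_iff]
    exact fun p _ hp => h ⟨p, hp⟩

theorem demand_le (q : Fin n) (k : ℕ) : demand t R GST q k ≤ numTargets t q k := by
  unfold demand
  split_ifs
  · exact le_rfl
  · exact Nat.zero_le _

/-- In an attempt, members ask the leader and the leader asks the members. In a service superview,
one party per group asks 3t+1 members, or each party asks at most one; both cost at most n. -/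
theorem sum_numTargets_le (hn : 3 * t < n) (k : ℕ) :
    ∑ q : Fin n, numTargets t q k ≤
      2 * (3 * t + 1) + if 3 * t + 1 ≤ k % (3 * t + 3) then n else 0 := by
  have hlt := Nat.mod_lt k (show 0 < 3 * t + 3 by omega)
  rcases lt_or_ge (k % (3 * t + 3)) (3 * t + 1) with hk | hk
  · refine (Finset.sum_le_sum fun q _ => numTargets_le_attempt hn q hk).trans ?_
    rw [if_neg (by omega), add_zero, Finset.sum_add_distrib, ← Finset.card_filter,
      ← Finset.sum_filter, Finset.sum_const, smul_eq_mul, Fin.card_filter_val_lt]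
    have : (Finset.univ.filter fun q : Fin n => q.val = k % (3 * t + 3)).card ≤ 1 := by
      rw [Finset.card_le_one]
      intro p hp q hq
      exact Fin.ext ((Finset.mem_filter.1 hp).2.trans (Finset.mem_filter.1 hq).2.symm)
    have := Nat.mul_le_mul_right (3 * t + 1) this
    omega
  · rw [if_pos hk]
    refine le_trans ?_ (Nat.le_add_left _ _)
    rcases Nat.lt_or_eq_of_le hk with hk | hk
    · refine (Finset.sum_le_sum fun q _ => numTargets_le_group q (by omega)).trans ?_
      rw [← Finset.card_filter]
      exact (Finset.card_le_univ _).trans_eq (Fintype.card_fin n)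
    · refine (Finset.sum_le_sum fun q _ => numTargets_le_committee hn q hk.symm).trans ?_
      rw [← Finset.sum_filter, Finset.sum_const, smul_eq_mul, mul_comm]
      refine mul_card_le_of_injOn_div (by omega) (fun q hq => (Finset.mem_filter.1 hq).2.1)
        (fun p hp q hq h => ?_)
      have h1 := (Finset.mem_filter.1 hp).2.2
      have h2 := (Finset.mem_filter.1 hq).2.2
      dsimp only at h
      rw [Fin.ext_iff, ← Nat.div_add_mod p.val (3 * t + 1), ← Nat.div_add_mod q.val (3 * t + 1),
        h1, h2, h]

/-- An interval of the length of two epochs meets at most three epochs, with two service superviews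
each. -/
theorem card_service_superviews_le (t a : ℕ) :
    ((Finset.Ico a (a + 6 * t + 6)).filter fun k => 3 * t + 1 ≤ k % (3 * t + 3)).card ≤ 6 := by
  have h6 : (Finset.Icc (a / (3 * t + 3)) (a / (3 * t + 3) + 2) ×ˢ
      ({3 * t + 1, 3 * t + 2} : Finset ℕ)).card ≤ 6 := by
    rw [Finset.card_product, Nat.card_Icc]
    have := Finset.card_le_two (a := 3 * t + 1) (b := 3 * t + 2)
    calc _ ≤ (a / (3 * t + 3) + 2 + 1 - a / (3 * t + 3)) * 2 := Nat.mul_le_mul_left _ this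
      _ = 6 := by omega
  refine le_trans (Finset.card_le_card_of_injOn (fun k => (k / (3 * t + 3), k % (3 * t + 3)))
    (fun k hk => ?_) (fun k _ k' _ h => ?_)) h6
  · obtain ⟨hk, hs⟩ := Finset.mem_filter.1 hk
    obtain ⟨h1, h2⟩ := Finset.mem_Ico.1 hk
    have hlt := Nat.mod_lt k (show 0 < 3 * t + 3 by omega)
    have h3 : k / (3 * t + 3) ≤ (a + (3 * t + 3) * 2) / (3 * t + 3) :=
      Nat.div_le_div_right (by omega)
    rw [Nat.add_mul_div_left _ _ (by omega)] at h3
    simp only [Finset.coe_product, Set.mem_prod, Finset.mem_coe, Finset.mem_Icc,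
      Finset.mem_insert, Finset.mem_singleton]
    exact ⟨⟨Nat.div_le_div_right h1, h3⟩, by omega⟩
  · simp only [Prod.mk.injEq] at h
    rw [← Nat.div_add_mod k (3 * t + 3), ← Nat.div_add_mod k' (3 * t + 3), h.1, h.2]

/-- Between two turns of the same representative the rotation passes through every residue `s`, so
every member of the group gets its turn with the committee. -/
theorem exists_asking_superview {k k' s : ℕ} (hk : k % (3 * t + 3) = 3 * t + 2)
    (hk' : k' % (3 * t + 3) = 3 * t + 2) (hlt : k < k')
    (he : k / (3 * t + 3) % (3 * t + 1) = k' / (3 * t + 3) % (3 * t + 1)) (hs : s < 3 * t + 1) :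
    ∃ j, k ≤ j + 1 ∧ j < k' ∧ j % (3 * t + 3) = 3 * t + 1 ∧
      j / (3 * t + 3) % (3 * t + 1) = s := by
  have h1 := Nat.div_add_mod k (3 * t + 3)
  have h2 := Nat.div_add_mod k' (3 * t + 3)
  rw [hk] at h1
  rw [hk'] at h2
  have hee : k / (3 * t + 3) < k' / (3 * t + 3) :=
    lt_of_mul_lt_mul_left (a := 3 * t + 3) (by omega) (by omega)
  generalize k / (3 * t + 3) = e at *
  generalize k' / (3 * t + 3) = e' at *
  obtain ⟨d, hd1, hd2, hd3⟩ : ∃ d, e ≤ d ∧ d < e' ∧ d % (3 * t + 1) = s := by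
    have h3 := Nat.div_add_mod e (3 * t + 1)
    have h4 := Nat.div_add_mod e' (3 * t + 1)
    have hr := Nat.mod_lt e (show 0 < 3 * t + 1 by omega)
    rw [← he] at h4
    generalize e % (3 * t + 1) = r at *
    have haa : e / (3 * t + 1) < e' / (3 * t + 1) :=
      lt_of_mul_lt_mul_left (a := 3 * t + 1) (by omega) (by omega)
    generalize e / (3 * t + 1) = a at *
    generalize e' / (3 * t + 1) = a' at *
    have h5 := Nat.mul_le_mul_left (3 * t + 1) (show a + 1 ≤ a' from haa)
    rw [mul_add, mul_one] at h5
    rcases le_or_gt r s with hrs | hrs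
    · refine ⟨(3 * t + 1) * a + s, by omega, by omega, ?_⟩
      rw [Nat.mul_add_mod, Nat.mod_eq_of_lt hs]
    · refine ⟨(3 * t + 1) * (a + 1) + s, by rw [mul_add]; omega, by rw [mul_add]; omega, ?_⟩
      rw [Nat.mul_add_mod, Nat.mod_eq_of_lt hs]
  have h3 := Nat.mul_le_mul_left (3 * t + 3) hd1
  have h4 := Nat.mul_le_mul_left (3 * t + 3) hd2.le
  refine ⟨(3 * t + 3) * d + (3 * t + 1), by omega, by omega, ?_, ?_⟩
  · rw [Nat.mul_add_mod, Nat.mod_eq_of_lt (by omega)]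
  · rw [Nat.mul_add_div (by omega), Nat.div_eq_of_lt (by omega), add_zero, hd3]

theorem succ_of_mod_eq {k : ℕ} (hk : k % (3 * t + 3) = 3 * t + 1) :
    (k + 1) % (3 * t + 3) = 3 * t + 2 ∧ (k + 1) / (3 * t + 3) = k / (3 * t + 3) := by
  have h1 := Nat.div_add_mod k (3 * t + 3)
  rw [hk] at h1
  generalize k / (3 * t + 3) = e at *
  have h2 : k + 1 = (3 * t + 3) * e + (3 * t + 2) := by omega
  rw [h2, Nat.mul_add_mod, Nat.mul_add_div (by omega), Nat.mod_eq_of_lt (by omega),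
    Nat.div_eq_of_lt (by omega)]
  exact ⟨rfl, rfl⟩

namespace Admissible

theorem demand_le_asks (H : Admissible t Δ GST R) {k0 k : ℕ} (h0 : Good t R GST k0)
    (hk : k0 < k) (q : Fin n) :
    demand t R GST q k ≤ (3 * t + 1) * (if AsksCommittee t R GST q k then 1 else 0) +
      if AsksGroup t R GST q k then 1 else 0 := by
  by_cases hl : Lacks R GST q k
  swap
  · exact (if_neg hl).trans_le (Nat.zero_le _)
  refine (demand_le q k).trans ?_
  have hlt := Nat.mod_lt k (show 0 < 3 * t + 3 by omega)
  have hq : 3 * t + 1 ≤ q.val := by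
    by_contra hq
    exact H.not_lacks_member h0 hk (not_le.1 hq) hl
  rcases lt_trichotomy (k % (3 * t + 3)) (3 * t + 1) with hs | hs | hs
  · have := numTargets_le_attempt H.resilience q hs
    rw [if_neg (by omega), if_neg (by omega)] at this
    exact this.trans (Nat.zero_le _)
  · refine (numTargets_le_committee H.resilience q hs).trans (le_trans ?_ (Nat.le_add_right _ _))
    split_ifs with h1 h2 h2
    · rw [mul_one]
    · exact absurd ⟨hs, h1.1, h1.2, hl⟩ h2
    · exact Nat.zero_le _
    · exact Nat.zero_le _
  · have hs : k % (3 * t + 3) = 3 * t + 2 := by omega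
    refine (numTargets_le_group q hs).trans (le_trans ?_ (Nat.le_add_left _ _))
    split_ifs with h1 h2 h2
    · exact le_rfl
    · exact absurd ⟨hs, h1, hl⟩ h2
    · exact Nat.zero_le _
    · exact Nat.zero_le _

theorem card_asksCommittee_le (H : Admissible t Δ GST R) {k0 : ℕ} (h0 : Good t R GST k0)
    (q : Fin n) (b : ℕ) :
    ((Finset.Ico (k0 + 1) b).filter fun k => AsksCommittee t R GST q k).card ≤ 1 := by
  rw [Finset.card_le_one]
  have key : ∀ k k', k0 < k → AsksCommittee t R GST q k → AsksCommittee t R GST q k' →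
      ¬ k < k' := fun k k' hk ⟨h1, h2, h3, _⟩ ⟨_, _, _, h⟩ hlt =>
    H.not_lacks_asker h0 hk hlt h1 h2 h3 h
  intro k hk k' hk'
  obtain ⟨hk, ha⟩ := Finset.mem_filter.1 hk
  obtain ⟨hk', ha'⟩ := Finset.mem_filter.1 hk'
  have h1 := key k k' (Finset.mem_Ico.1 hk).1 ha ha'
  have h2 := key k' k (Finset.mem_Ico.1 hk').1 ha' ha
  omega

/-- In the superview right after an honest `l` has asked the committee, the rest of its group can
ask `l` and is served. -/
theorem not_asksCommittee_of_lt (H : Admissible t Δ GST R) {k0 k k' : ℕ}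
    (h0 : Good t R GST k0) (hk : k0 < k) (hkk : k < k') {l q : Fin n} (hl : R.Honest l)
    (hg : l.val / (3 * t + 1) = q.val / (3 * t + 1)) (hlk : AsksCommittee t R GST l k) :
    ¬ AsksCommittee t R GST q k' := by
  rintro ⟨hs', hq, -, hlack⟩
  obtain ⟨hs, -, hr, -⟩ := hlk
  obtain ⟨h1, h2⟩ := succ_of_mod_eq hs
  have hlt : k + 1 < k' := by
    have : k + 1 ≠ k' := by
      rintro rfl
      omega
    omega
  refine H.not_lacks_group h0 (by omega) hlt h1 (Or.inr (Or.inr ⟨hq, h1, ?_⟩)) hl hlack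
  rw [h2, ← hr, ← hg, mul_comm, Nat.div_add_mod]

/-- Each party asks at most once. The faulty askers number at most f, and the honest ones lie in
distinct groups. -/
theorem sum_asksCommittee_le (H : Admissible t Δ GST R) {k0 : ℕ} (h0 : Good t R GST k0) (b : ℕ) :
    (3 * t + 1) * ∑ q, ((Finset.Ico (k0 + 1) b).filter fun k => AsksCommittee t R GST q k).card ≤
      (3 * t + 1) * R.numFaulty + n := by
  set Q := Finset.univ.filter fun q => ∃ k, k0 < k ∧ AsksCommittee t R GST q k with hQ
  have h1 : ∑ q, ((Finset.Ico (k0 + 1) b).filter fun k => AsksCommittee t R GST q k).card ≤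
      Q.card := by
    rw [hQ, Finset.card_filter]
    refine Finset.sum_le_sum fun q _ => ?_
    split_ifs with h
    · exact H.card_asksCommittee_le h0 q b
    · rw [Nat.le_zero, Finset.card_eq_zero, Finset.filter_eq_empty_iff]
      exact fun k hk ha => h ⟨k, (Finset.mem_Ico.1 hk).1, ha⟩
  have h2 := Finset.card_filter_add_card_filter_not (s := Q) (fun q => R.Honest q)
  have h3 : (Q.filter fun q => ¬ R.Honest q).card ≤ R.numFaulty :=
    Finset.card_le_card (Finset.filter_subset_filter _ (Finset.subset_univ _))
  have h4 : (3 * t + 1) * (Q.filter fun q => R.Honest q).card ≤ n := by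
    refine mul_card_le_of_injOn_div (by omega) (fun q hq => ?_) (fun p hp q hq h => ?_)
    · obtain ⟨k, -, -, h, -⟩ := (Finset.mem_filter.1 (Finset.mem_filter.1 hq).1).2
      exact h
    · obtain ⟨hp, hph⟩ := Finset.mem_filter.1 hp
      obtain ⟨hq, hqh⟩ := Finset.mem_filter.1 hq
      obtain ⟨k, hk, hpk⟩ := (Finset.mem_filter.1 hp).2
      obtain ⟨k', hk', hqk⟩ := (Finset.mem_filter.1 hq).2
      rcases lt_trichotomy k k' with hlt | rfl | hlt
      · exact absurd hqk (H.not_asksCommittee_of_lt h0 hk hlt hph h hpk)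
      · dsimp only at h
        rw [Fin.ext_iff, ← Nat.div_add_mod p.val (3 * t + 1),
          ← Nat.div_add_mod q.val (3 * t + 1), h, hpk.2.2.1, hqk.2.2.1]
      · exact absurd hpk (H.not_asksCommittee_of_lt h0 hk' hlt hqh h.symm hqk)
  calc _ ≤ (3 * t + 1) * Q.card := Nat.mul_le_mul_left _ h1
    _ ≤ (3 * t + 1) * (R.numFaulty + (Q.filter fun q => R.Honest q).card) :=
      Nat.mul_le_mul_left _ (by omega)
    _ ≤ _ := by
      rw [mul_add]
      omega

theorem card_asksGroup_le (H : Admissible t Δ GST R) {k0 : ℕ} (h0 : Good t R GST k0)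
    (q : Fin n) (b : ℕ) :
    ((Finset.Ico (k0 + 1) b).filter fun k => AsksGroup t R GST q k).card ≤
      1 + (Finset.univ.filter fun l : Fin n =>
        ¬ R.Honest l ∧ q.val / (3 * t + 1) = l.val / (3 * t + 1)).card := by
  set K := (Finset.Ico (k0 + 1) b).filter fun k => AsksGroup t R GST q k with hK
  rcases K.eq_empty_or_nonempty with he | hne
  · simp [he]
  have hmem : ∀ k ∈ K, k0 < k ∧ AsksGroup t R GST q k := fun k hk =>
    ⟨(Finset.mem_Ico.1 (Finset.mem_filter.1 hk).1).1, (Finset.mem_filter.1 hk).2⟩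
  have hex : ∀ k, ∃ l, k ∈ K → Target t q l k := by
    intro k
    by_cases hk : k ∈ K
    · obtain ⟨l, hl⟩ := (hmem k hk).2.2.1
      exact ⟨l, fun _ => hl⟩
    · exact ⟨q, fun h => absurd h hk⟩
  choose l hl using hex
  have hval : ∀ k ∈ K, 3 * t + 1 ≤ q.val ∧ (l k).val =
      q.val / (3 * t + 1) * (3 * t + 1) + k / (3 * t + 3) % (3 * t + 1) := by
    intro k hk
    have hs := (hmem k hk).2.1
    rcases hl k hk with ⟨-, -, h, -⟩ | ⟨-, -, h, -⟩ | ⟨h, -, h'⟩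
    · omega
    · omega
    · exact ⟨h, h'⟩
  have hne_of_lt : ∀ k ∈ K, ∀ k' ∈ K, k < k' → l k ≠ l k' := by
    intro k hk k' hk' hlt heq
    obtain ⟨hq, h1⟩ := hval k hk
    have h2 := (hval k' hk').2
    rw [heq] at h1
    obtain ⟨j, hj1, hj2, hj3, hj4⟩ := exists_asking_superview (hmem k hk).2.1 (hmem k' hk').2.1 hlt
      (by omega) (Nat.mod_lt q.val (show 0 < 3 * t + 1 by omega))
    obtain ⟨-, l0, -, hl0⟩ := id h0
    have hlt0 := hl0.lt
    have hk0 := (hmem k hk).1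
    have hj : k0 < j := by
      rcases Nat.lt_or_eq_of_le (show k0 ≤ j by omega) with h | rfl
      · exact h
      · omega
    exact H.not_lacks_asker h0 hj hj2 hj3 hq hj4.symm (hmem k' hk').2.2.2
  -- The last request is set aside. Every earlier one was in vain, so its target is faulty; the
  -- targets are distinct because after a full rotation `q` itself would have asked the committee.
  rw [← Nat.sub_le_iff_le_add', ← Finset.card_erase_of_mem (K.max'_mem hne)]
  refine Finset.card_le_card_of_injOn l (fun k hk => ?_) (fun k hk k' hk' h => ?_)
  · have hk' := Finset.mem_of_mem_erase hk
    have hlt := Finset.lt_max'_of_mem_erase_max' K hne hk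
    refine Finset.mem_filter.2 ⟨Finset.mem_univ _, fun hh => ?_, ?_⟩
    · exact H.not_lacks_group h0 (hmem k hk').1 hlt (hmem k hk').2.1 (hl k hk') hh
        (hmem _ (K.max'_mem hne)).2.2.2
    · rcases (hl k hk').div_eq_or_lt with h | h
      · obtain ⟨hq, h1⟩ := hval k hk'
        have := Nat.mul_le_mul_right (3 * t + 1) ((Nat.one_le_div_iff (by omega)).2 hq)
        omega
      · exact h.symm
  · have hk := Finset.mem_of_mem_erase hk
    have hk' := Finset.mem_of_mem_erase hk'
    rcases lt_trichotomy k k' with hlt | rfl | hlt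
    · exact absurd h (hne_of_lt k hk k' hk' hlt)
    · rfl
    · exact absurd h.symm (hne_of_lt k' hk' k hk hlt)

theorem sum_asksGroup_le (H : Admissible t Δ GST R) {k0 : ℕ} (h0 : Good t R GST k0) (b : ℕ) :
    ∑ q, ((Finset.Ico (k0 + 1) b).filter fun k => AsksGroup t R GST q k).card ≤
      n + (3 * t + 1) * R.numFaulty := by
  refine (Finset.sum_le_sum fun q _ => H.card_asksGroup_le h0 q b).trans ?_
  rw [Finset.sum_add_distrib, Finset.sum_const, Finset.card_univ, Fintype.card_fin, smul_eq_mul,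
    mul_one]
  refine Nat.add_le_add_left ?_ n
  simp only [← Finset.filter_filter]
  simp only [Finset.card_filter _ (Finset.univ.filter _)]
  rw [Finset.sum_comm, Run.numFaulty, mul_comm (3 * t + 1)]
  refine Finset.sum_le_card_nsmul _ _ _ fun l _ => ?_
  rw [← Finset.card_filter]
  exact card_group_le t _

theorem sum_demand_early_le (H : Admissible t Δ GST R) {a k0 : ℕ}
    (hk0 : k0 ≤ a + R.numFaulty + 4) :
    ∑ k ∈ Finset.Ico a (k0 + 1), ∑ q, demand t R GST q k ≤
      2 * (3 * t + 1) * (R.numFaulty + 5) + 6 * n := by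
  have hf := H.numFaulty_le
  have h1 : ∀ k, ∑ q, demand t R GST q k ≤
      2 * (3 * t + 1) + if 3 * t + 1 ≤ k % (3 * t + 3) then n else 0 := fun k =>
    (Finset.sum_le_sum fun q _ => demand_le q k).trans (sum_numTargets_le H.resilience k)
  refine (Finset.sum_le_sum fun k _ => h1 k).trans ?_
  rw [Finset.sum_add_distrib, Finset.sum_const, smul_eq_mul, Nat.card_Ico, ← Finset.sum_filter,
    Finset.sum_const, smul_eq_mul]
  -- The interval has at most f + 5 ≤ t + 5 superviews, which fits into two epochs.
  have h2 : ((Finset.Ico a (k0 + 1)).filter fun k => 3 * t + 1 ≤ k % (3 * t + 3)).card ≤ 6 :=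
    (Finset.card_le_card (Finset.filter_subset_filter _
      (Finset.Ico_subset_Ico_right (by omega)))).trans (card_service_superviews_le t a)
  refine Nat.add_le_add ?_ (Nat.mul_le_mul_right n h2)
  rw [mul_comm]
  exact Nat.mul_le_mul_left _ (by omega)

theorem sum_demand_late_le (H : Admissible t Δ GST R) {k0 : ℕ} (h0 : Good t R GST k0) (b : ℕ) :
    ∑ k ∈ Finset.Ico (k0 + 1) b, ∑ q, demand t R GST q k ≤
      2 * (3 * t + 1) * R.numFaulty + 2 * n := by
  have h1 := H.sum_asksCommittee_le h0 b
  have h2 := H.sum_asksGroup_le h0 b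
  simp only [Finset.card_filter] at h1 h2
  rw [Finset.sum_comm]
  calc _ ≤ ∑ q, ∑ k ∈ Finset.Ico (k0 + 1) b,
        ((3 * t + 1) * (if AsksCommittee t R GST q k then 1 else 0) +
          if AsksGroup t R GST q k then 1 else 0) :=
        Finset.sum_le_sum fun q _ => Finset.sum_le_sum fun k hk =>
          H.demand_le_asks h0 (Finset.mem_Ico.1 hk).1 q
    _ ≤ ((3 * t + 1) * R.numFaulty + n) + (n + (3 * t + 1) * R.numFaulty) := by
        simp only [Finset.sum_add_distrib, ← Finset.mul_sum]
        exact Nat.add_le_add h1 h2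
    _ = _ := by ring

theorem wordsSent_le_linear (H : Admissible t Δ GST R) {a k0 : ℕ} (h0 : Good t R GST k0)
    (hk0 : k0 ≤ a + R.numFaulty + 4)
    (ha : ∀ q τ, GST ≤ τ → R.Uncorrupted q τ → 7 * a ≤ R.view q τ) (T : ℕ) :
    R.wordsSent (protocol t n) GST T ≤ 252 * (n + t * R.numFaulty) := by
  obtain ⟨b, hb⟩ := H.wordsSent_le T ha
  have h1 := H.sum_demand_early_le hk0
  have h2 := H.sum_demand_late_le h0 b
  have h3 : ∑ k ∈ Finset.Ico a b, ∑ q, demand t R GST q k ≤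
      ∑ k ∈ Finset.Ico a (k0 + 1), ∑ q, demand t R GST q k +
        ∑ k ∈ Finset.Ico (k0 + 1) b, ∑ q, demand t R GST q k := by
    rw [← Finset.sum_union_inter]
    refine (Finset.sum_le_sum_of_subset fun k hk => ?_).trans (Nat.le_add_right _ _)
    rw [Finset.mem_union, Finset.mem_Ico, Finset.mem_Ico]
    have := Finset.mem_Ico.1 hk
    omega
  have hf := H.numFaulty_le
  have hn := H.resilience
  have hft : R.numFaulty ≤ t * R.numFaulty := by
    rcases Nat.eq_zero_or_pos R.numFaulty with h | h
    · rw [h]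
      exact Nat.zero_le _
    · exact Nat.le_mul_of_pos_left _ (by omega)
  have h4 : (3 * t + 1) * R.numFaulty = 3 * (t * R.numFaulty) + R.numFaulty := by ring
  rw [mul_assoc] at hb h2
  rw [mul_assoc, mul_add] at h1
  -- The constant is 252 = 14 · 18: of the 18 copies of n, 8 come from the two demand bounds, and 10
  -- absorb 10(3t+1).
  omega

end Admissible

end CommitteeBA

end PartialSynchrony

theorem theorem1 :
    ∃ r c L C : ℕ, ∀ n t Δ : ℕ, 3 * t < n → 0 < Δ →
      ∃ P : PartialSynchrony.Protocol n r c,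
        ∀ (GST : ℕ) (R : PartialSynchrony.Run n r c),
          R.numFaulty ≤ t → R.IsExecution P → R.PartiallySynchronous P Δ GST →
          R.ViewsSynchronized (L * Δ) GST →
            R.Termination P ∧ R.Agreement P ∧ R.StrongUnanimity P ∧
              ∀ T : ℕ, R.wordsSent P GST T ≤ C * (n + t * R.numFaulty) := by
  refine ⟨2, 2, 2, 252, fun n t Δ hn hΔ => ⟨PartialSynchrony.CommitteeBA.protocol t n, ?_⟩⟩
  intro GST R hf hE hS hV
  have H : PartialSynchrony.CommitteeBA.Admissible t Δ GST R := ⟨hn, hΔ, hf, hE, hS, hV⟩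
  obtain ⟨a, k0, hle, h0, ha⟩ := H.exists_good
  have hT := H.termination h0
  exact ⟨hT, H.agreement, H.strongUnanimity_of_termination hT, H.wordsSent_le_linear h0 hle ha⟩
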